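/- Let $n\ge 0$ be an integer and let $\mathrm{Par}_n$ be the set of partitions with at most $n$ parts. Partitions are identified with their Young diagrams. For a finite set $D$ of boxes, $\mathrm{SSYT}(D,n)$ is the set of fillings of $D$ with labels in $\{1,\dots,n\}$ that are weakly increasing along rows and strictly increasing down columns. For $\nu\subseteq\lambda$, $\lambda/\nu$ is the set of boxes of $\lambda$ not in $\nu$, $|\lambda/\nu|$ is the number of these boxes, and $f^{\lambda/\nu}$ is the number of standard Young tableaux of shape $\lambda/\nu$ (the tableaux in $\mathrm{SSYT}(\lambda/\nu,|\lambda/\nu|)$ that use every label exactly once); $f^\lambda=f^{\lambda/\emptyset}$. A box in row $r$ and column $c$, counted from $1$, is written $(r,c)$. Let $$s_\lambda(x_1,\dots,x_n)=\sum_{T\in \mathrm{SSYT}(\lambda,n)}\ \prod_{b\in\lambda}x_{T(b)}\in\mathbb{C}[x_1,\dots,x_n]$$ be the Schur polynomial, and let $$\overline{s}_\lambda(x_1,\dots,x_n)=s_\lambda\big((x_1+\dots+x_n)-x_1,\ \dots,\ (x_1+\dots+x_n)-x_n\big).$$ **(a)** For every $\lambda\in\mathrm{Par}_n$, $$\overline{s}_\lambda(x_1,\dots,x_n)=\sum_{\nu\subseteq\lambda}(-1)^{|\nu|}\,s_\nu(x_1,\dots,x_n)\,s_{(1)}(x_1,\dots,x_n)^{|\lambda/\nu|}\,f^{\lambda/\nu}\,\frac{\prod_{(r,c)\in\lambda/\nu}(n-r+c)}{|\lambda/\nu|!}.$$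 **(b)** For every $\lambda\in\mathrm{Par}_n$, the polynomial $\overline{s}_\lambda(x_1,\dots,x_n)$ can be written in exactly one way as a finite linear combination, with coefficients in $\mathbb{C}$, of the polynomials $s_\mu(x_1,\dots,x_n)$ with $\mu\in\mathrm{Par}_n$. Let $[s_\mu]\overline{s}_\lambda$ denote the coefficient of $s_\mu$. If $|\mu|\neq|\lambda|$, then $[s_\mu]\overline{s}_\lambda=0$. If $|\mu|=|\lambda|$, then $$[s_\mu]\overline{s}_\lambda=\sum_{\nu\subseteq\lambda\cap\mu}(-1)^{|\nu|}\,\frac{f^{\lambda/\nu}f^{\mu/\nu}\prod_{(r,c)\in\lambda/\nu}(n-r+c)}{|\lambda/\nu|!}.$$ **(c)** For all $\lambda,\mu\in\mathrm{Par}_n$, $$\sum_{\nu\subseteq\lambda\cap\mu}(-1)^{|\nu|}\,\frac{f^{\lambda/\nu}f^{\mu/\nu}\prod_{(r,c)\in\lambda/\nu}(n-r+c)}{|\lambda/\nu|!}=\sum_{\nu\subseteq\lambda\cap\mu}(-1)^{|\nu|}\binom{|\lambda|}{|\nu|}f^{\mu/\nu}\,\frac{f^{\nu}f^{\lambda/\nu}}{f^{\lambda}}\,\frac{|\mathrm{SSYT}(\lambda,n)|}{|\mathrm{SSYT}(\nu,n)|},$$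 so that for $|\mu|=|\lambda|$ the right-hand side is also equal to $[s_\mu]\overline{s}_\lambda$. -/

import Mathlib

/-! Boxes of a diagram are Mathlib's pairs `(i, j)` of a row index and a column index, both counted
from `0`; the box that is written `(r, c)` with indices counted from `1` is `(i, j) = (r - 1, c - 1)`. -/

/-- Partitions with at most `n` (positive) parts: Young diagrams whose first column has at most `n`
boxes. -/
abbrev Par (n : ℕ) : Type := {lam : YoungDiagram // lam.colLen 0 ≤ n}

/-- The boxes of the skew shape `lam / nu`. -/
def skewCells (lam nu : YoungDiagram) : Finset (ℕ × ℕ) := lam.cells \ nu.cells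

/-- Semistandard fillings of a finite set `D` of boxes with the `n` labels in `Fin n`: weakly
increasing along rows and strictly increasing down columns. -/
def IsSSYT {n : ℕ} (D : Finset (ℕ × ℕ)) (T : D → Fin n) : Prop :=
  (∀ a b : D, a.1.1 = b.1.1 → a.1.2 < b.1.2 → T a ≤ T b) ∧
  (∀ a b : D, a.1.2 = b.1.2 → a.1.1 < b.1.1 → T a < T b)

open scoped Classical in
/-- The finite set of semistandard tableaux of shape `D` with labels in an `n`-element chain. -/
noncomputable def SSYT (D : Finset (ℕ × ℕ)) (n : ℕ) : Finset (D → Fin n) :=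
  Finset.univ.filter (fun T => IsSSYT D T)

open scoped Classical in
/-- The semistandard tableaux that use each label at most once and increase strictly along rows. -/
noncomputable def SYT (D : Finset (ℕ × ℕ)) (n : ℕ) : Finset (D → Fin n) :=
  (SSYT D n).filter (fun T => Function.Injective T ∧
    ∀ a b : D, a.1.1 = b.1.1 → a.1.2 < b.1.2 → T a < T b)

open scoped Classical in
/-- `f^{lam / nu}`: the number of standard Young tableaux of shape `lam / nu`, whose labels are
`|lam / nu|` many; it is `0` if `nu` is not contained in `lam`. -/
noncomputable def numSYT (lam nu : YoungDiagram) : ℕ :=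
  if nu ≤ lam then (SYT (skewCells lam nu) (skewCells lam nu).card).card else 0

/-- The Schur polynomial `s_lam(x_1, …, x_n)`: the sum over all semistandard tableaux `T` of shape
`lam` of the product of the variables `x_{T(b)}` over all boxes `b`, which is `x^{wt(T)}`. -/
noncomputable def schur (n : ℕ) (lam : YoungDiagram) : MvPolynomial (Fin n) ℂ :=
  ∑ T ∈ SSYT lam.cells n, ∏ b : lam.cells, MvPolynomial.X (T b)

/-- The polynomial `s_lam(e - x_1, …, e - x_n)` with `e = x_1 + ⋯ + x_n`. -/
noncomputable def schurBar (n : ℕ) (lam : YoungDiagram) : MvPolynomial (Fin n) ℂ :=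
  MvPolynomial.aeval
    (fun i : Fin n => (∑ j : Fin n, MvPolynomial.X j) - MvPolynomial.X i) (schur n lam)

/-- The diagram of the partition `(1)`. -/
def oneBox : YoungDiagram := YoungDiagram.ofRowLens [1] (List.sortedGE_iff_pairwise.mpr (List.pairwise_singleton _ _))

theorem finite_subdiagrams (lam : YoungDiagram) : {nu : YoungDiagram | nu ≤ lam}.Finite := by
  refine Set.Finite.of_finite_image (f := YoungDiagram.cells)
    (Set.Finite.subset (lam.cells.powerset.finite_toSet) ?_) ?_
  · rintro _ ⟨nu, h, rfl⟩
    simpa using h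
  · intro a _ b _ h
    exact YoungDiagram.ext h

/-- The finite set of all partitions `nu ⊆ lam`. -/
noncomputable def subdiagrams (lam : YoungDiagram) : Finset YoungDiagram :=
  (finite_subdiagrams lam).toFinset

/-- The product of `n - r + c` over the boxes `(r, c)` of `lam / nu`, where `r` and `c` count from
`1`. -/
noncomputable def contentProd (n : ℕ) (lam nu : YoungDiagram) : ℂ :=
  ∏ b ∈ skewCells lam nu, ((n : ℂ) - ((b.1 : ℂ) + 1) + ((b.2 : ℂ) + 1))

/-- `c` is the family of coefficients of an expansion of `p` as a linear combination of the Schur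
polynomials that are indexed by partitions with at most `n` parts. -/
def IsSchurExpansion {n : ℕ} (p : MvPolynomial (Fin n) ℂ) (c : Par n →₀ ℂ) : Prop :=
  p = c.sum (fun mu a => a • schur n mu.1)

open Finset

/-! Substitute `t - x_i` for `x_i` in `s_lam` and regard the result as a polynomial in a new
variable `t`. Its `t`-derivative is the same substitution applied to `D s_lam`, where `D = ∂/∂x_1 +
⋯ + ∂/∂x_n`. The operator `D` removes one box in every possible way, weighted by the factor `n - r +
c` of that box (`gradSum_schur`). The proposed Taylor expansion obeys the same recursion, because
standard tableaux are counted by removing the box with the largest label (`numSYT_eq_sum`,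
`card_mul_shiftCoeff`). Both sides agree at `t = 0`, so induction on the number of boxes gives
`shiftHom_schur`. Setting `t = x_1 + ⋯ + x_n` yields (a).

Both the rule for `D` and Pieri's rule for `s_(1)` are read off from the bialternant formula
`tableauSum_mul_alternant`: on alternants, `D` lowers one exponent, multiplication by `x_1 + ⋯ +
x_n` raises one, and `D` kills the Vandermonde determinant. The bialternant formula itself is proved
by induction on `n`: deleting the largest label from tableaux matches an expansion of the alternant
along its last row.

For (b), iterating Pieri's rule expands `s_nu s_(1)^k` in Schur polynomials, and these are
independent because distinct strictly increasing exponents give alternants with distinct leading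
monomials. For (c), the same Taylor expansion at `x = 0`, `t = 1` evaluates `|SSYT(lam, n)|`
(`card_SSYT_eq`); the ratio for `lam` and `nu` then produces the product over `lam / nu`, and the
two sums agree term by term. -/

theorem mem_SSYT {D : Finset (ℕ × ℕ)} {n : ℕ} {T : D → Fin n} : T ∈ SSYT D n ↔ IsSSYT D T := by
  simp [SSYT]

/-! ### Removing the largest label from a filling -/

/-- Extend a filling of a part of `D` by a new largest label on the remaining boxes of `D`. -/
def extendFilling {m : ℕ} {D : Finset (ℕ × ℕ)} (E : Finset (ℕ × ℕ)) (T : E → Fin m) :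
    D → Fin (m + 1) :=
  fun b => if h : b.1 ∈ E then (T ⟨b.1, h⟩).castSucc else Fin.last m

theorem extendFilling_of_mem {m : ℕ} {D E : Finset (ℕ × ℕ)} (T : E → Fin m) (b : D)
    (h : b.1 ∈ E) : extendFilling E T b = (T ⟨b.1, h⟩).castSucc := dif_pos h

theorem extendFilling_of_notMem {m : ℕ} {D E : Finset (ℕ × ℕ)} (T : E → Fin m) (b : D)
    (h : b.1 ∉ E) : extendFilling E T b = Fin.last m := dif_neg h

theorem extendFilling_eq_last_iff {m : ℕ} {D E : Finset (ℕ × ℕ)} (T : E → Fin m) (b : D) :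
    extendFilling E T b = Fin.last m ↔ b.1 ∉ E := by
  constructor
  · intro h hb
    rw [extendFilling_of_mem T b hb] at h
    exact (Fin.castSucc_lt_last _).ne h
  · exact extendFilling_of_notMem T b

theorem exists_extendFilling_eq {m : ℕ} {D : Finset (ℕ × ℕ)} (T : D → Fin (m + 1)) :
    ∃ E ⊆ D, ∃ T' : E → Fin m, extendFilling E T' = T := by
  classical
  have key : ∀ b : ℕ × ℕ, b ∈ D.filter (fun b => ∃ h : b ∈ D, T ⟨b, h⟩ ≠ Fin.last m) ↔
      ∃ h : b ∈ D, T ⟨b, h⟩ ≠ Fin.last m := fun b => by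
    rw [mem_filter]
    exact ⟨fun h => h.2, fun h => ⟨h.1, h⟩⟩
  refine ⟨D.filter (fun b => ∃ h : b ∈ D, T ⟨b, h⟩ ≠ Fin.last m), filter_subset _ _,
    fun b => (T ⟨b.1, ((key _).1 b.2).1⟩).castPred ((key _).1 b.2).2, ?_⟩
  funext b
  by_cases hb : T b = Fin.last m
  · rw [hb, extendFilling_eq_last_iff, key]
    rintro ⟨h, h'⟩
    exact h' hb
  · rw [extendFilling_of_mem _ b ((key _).2 ⟨b.2, hb⟩)]
    simp

theorem extendFilling_injective {m : ℕ} {D E : Finset (ℕ × ℕ)} (hE : E ⊆ D) :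
    Function.Injective (fun T : E → Fin m => (extendFilling E T : D → Fin (m + 1))) := by
  intro T T' h
  funext b
  have := congrFun h ⟨b.1, hE b.2⟩
  simp only at this
  rw [extendFilling_of_mem T ⟨b.1, hE b.2⟩ b.2, extendFilling_of_mem T' ⟨b.1, hE b.2⟩ b.2] at this
  exact Fin.castSucc_injective _ this

theorem eq_of_extendFilling_eq {m : ℕ} {D E E' : Finset (ℕ × ℕ)} (hE : E ⊆ D) (hE' : E' ⊆ D)
    {T : E → Fin m} {T' : E' → Fin m}
    (h : (extendFilling E T : D → Fin (m + 1)) = extendFilling E' T') : E = E' := by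
  ext b
  constructor
  · intro hb
    by_contra hb'
    exact (extendFilling_eq_last_iff T ⟨b, hE hb⟩).1
      (h ▸ (extendFilling_eq_last_iff T' ⟨b, hE hb⟩).2 hb') hb
  · intro hb
    by_contra hb'
    exact (extendFilling_eq_last_iff T' ⟨b, hE' hb⟩).1
      (h ▸ (extendFilling_eq_last_iff T ⟨b, hE' hb⟩).2 hb') hb

/-- The new label fills `D \ E`. Row monotonicity forbids a box of `E` to the right of such a box;
column strictness forbids any box of `D` below one. -/
theorem isSSYT_extendFilling_iff {m : ℕ} {D E : Finset (ℕ × ℕ)} (hE : E ⊆ D) (T : E → Fin m) :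
    IsSSYT D (extendFilling E T) ↔ IsSSYT E T ∧
      (∀ a ∈ D, ∀ b ∈ E, a.1 = b.1 → a.2 < b.2 → a ∈ E) ∧
      (∀ a ∈ D, ∀ b ∈ D, a.2 = b.2 → a.1 < b.1 → a ∈ E) := by
  constructor
  · rintro ⟨h1, h2⟩
    refine ⟨⟨fun a b hab hab' => ?_, fun a b hab hab' => ?_⟩, fun a ha b hb hab hab' => ?_,
      fun a ha b hb hab hab' => ?_⟩
    · have := h1 ⟨a.1, hE a.2⟩ ⟨b.1, hE b.2⟩ hab hab'
      rwa [extendFilling_of_mem T ⟨a.1, hE a.2⟩ a.2, extendFilling_of_mem T ⟨b.1, hE b.2⟩ b.2,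
        Fin.castSucc_le_castSucc_iff] at this
    · have := h2 ⟨a.1, hE a.2⟩ ⟨b.1, hE b.2⟩ hab hab'
      rwa [extendFilling_of_mem T ⟨a.1, hE a.2⟩ a.2, extendFilling_of_mem T ⟨b.1, hE b.2⟩ b.2,
        Fin.castSucc_lt_castSucc_iff] at this
    · by_contra hna
      have := h1 ⟨a, ha⟩ ⟨b, hE hb⟩ hab hab'
      rw [extendFilling_of_notMem T _ hna, extendFilling_of_mem T _ hb] at this
      exact absurd (Fin.castSucc_lt_last _) (not_lt.2 this)
    · by_contra hna
      have := h2 ⟨a, ha⟩ ⟨b, hb⟩ hab hab'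
      rw [extendFilling_of_notMem T _ hna] at this
      exact absurd this (not_lt.2 (Fin.le_last _))
  · rintro ⟨⟨h1, h2⟩, h3, h4⟩
    refine ⟨fun a b hab hab' => ?_, fun a b hab hab' => ?_⟩
    · by_cases hb : b.1 ∈ E
      · have ha := h3 _ a.2 _ hb hab hab'
        rw [extendFilling_of_mem T _ ha, extendFilling_of_mem T _ hb,
          Fin.castSucc_le_castSucc_iff]
        exact h1 ⟨a.1, ha⟩ ⟨b.1, hb⟩ hab hab'
      · rw [extendFilling_of_notMem T _ hb]
        exact Fin.le_last _
    · have ha := h4 _ a.2 _ b.2 hab hab'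
      rw [extendFilling_of_mem T _ ha]
      by_cases hb : b.1 ∈ E
      · rw [extendFilling_of_mem T _ hb, Fin.castSucc_lt_castSucc_iff]
        exact h2 ⟨a.1, ha⟩ ⟨b.1, hb⟩ hab hab'
      · rw [extendFilling_of_notMem T _ hb]
        exact Fin.castSucc_lt_last _

theorem mem_subdiagrams {lam nu : YoungDiagram} : nu ∈ subdiagrams lam ↔ nu ≤ lam := by
  simp [subdiagrams]

/-- The value at `x` of the generating function of the semistandard fillings of `D`. -/
noncomputable def tableauSum {R : Type*} [CommRing R] (D : Finset (ℕ × ℕ)) {n : ℕ}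
    (x : Fin n → R) : R :=
  ∑ T ∈ SSYT D n, ∏ b : D, x (T b)

theorem tableauSum_empty {R : Type*} [CommRing R] {n : ℕ} (x : Fin n → R) :
    tableauSum ∅ x = 1 := by
  have h : SSYT ∅ n = {fun b => absurd b.2 (notMem_empty _)} := by
    ext T
    simp only [mem_SSYT, mem_singleton]
    exact ⟨fun _ => funext fun b => absurd b.2 (notMem_empty _),
      fun _ => ⟨fun a => absurd a.2 (notMem_empty _), fun a => absurd a.2 (notMem_empty _)⟩⟩
  rw [tableauSum, h]
  simp

open scoped Classical in
/-- The diagrams `mu ⊆ lam` for which `lam / mu` is a horizontal strip. -/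
noncomputable def horizontalStrips (lam : YoungDiagram) : Finset YoungDiagram :=
  (subdiagrams lam).filter (fun mu => ∀ i j, (i + 1, j) ∈ lam → (i, j) ∈ mu)

theorem mem_horizontalStrips {lam mu : YoungDiagram} :
    mu ∈ horizontalStrips lam ↔ mu ≤ lam ∧ ∀ i j, (i + 1, j) ∈ lam → (i, j) ∈ mu := by
  simp [horizontalStrips, mem_subdiagrams]

theorem isSSYT_extendFilling_cells_iff {m : ℕ} {lam mu : YoungDiagram} (h : mu ≤ lam)
    (T : mu.cells → Fin m) :
    IsSSYT lam.cells (extendFilling mu.cells T) ↔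
      IsSSYT mu.cells T ∧ ∀ i j, (i + 1, j) ∈ lam → (i, j) ∈ mu := by
  rw [isSSYT_extendFilling_iff h]
  refine and_congr_right fun _ => ⟨fun h' i j hij => ?_, fun h' => ⟨?_, ?_⟩⟩
  · exact h'.2 (i, j) (lam.up_left_mem (Nat.le_succ i) le_rfl hij) (i + 1, j) hij rfl
      (Nat.lt_succ_self i)
  · rintro ⟨i, j⟩ _ ⟨i', j'⟩ hb hab hab'
    exact mu.up_left_mem (le_of_eq hab) (le_of_lt hab') hb
  · rintro ⟨i, j⟩ _ ⟨i', j'⟩ hb hab hab'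
    simp only at hab hab'
    subst hab
    exact h' i j (lam.up_left_mem hab' le_rfl hb)

theorem prod_extendFilling {R : Type*} [CommRing R] {m : ℕ} {D E : Finset (ℕ × ℕ)} (hE : E ⊆ D)
    (T : E → Fin m) (x : Fin (m + 1) → R) :
    ∏ b : D, x (extendFilling E T b) =
      x (Fin.last m) ^ (D \ E).card * ∏ b : E, x (T b).castSucc := by
  let g : ℕ × ℕ → R := fun b => if h : b ∈ E then x (T ⟨b, h⟩).castSucc else x (Fin.last m)
  have h1 : ∏ b : D, x (extendFilling E T b) = ∏ b ∈ D, g b := by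
    rw [← prod_coe_sort D g]
    refine prod_congr rfl fun b _ => ?_
    by_cases hb : b.1 ∈ E
    · rw [extendFilling_of_mem T b hb]
      simp [g, hb]
    · rw [extendFilling_of_notMem T b hb]
      simp [g, hb]
  have h2 : ∏ b : E, x (T b).castSucc = ∏ b ∈ E, g b := by
    rw [← prod_coe_sort E g]
    refine prod_congr rfl fun b _ => ?_
    simp [g]
  rw [h1, h2, ← prod_sdiff hE]
  congr 1
  rw [← prod_const]
  refine prod_congr rfl fun b hb => ?_
  simp [g, (mem_sdiff.1 hb).2]

/-- Branching rule: the boxes with non-maximal labels form a diagram whose complement in `lam` is a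
horizontal strip, and each box of the strip contributes the last variable. -/
theorem tableauSum_succ {R : Type*} [CommRing R] (lam : YoungDiagram) {n : ℕ}
    (x : Fin (n + 1) → R) :
    tableauSum lam.cells x = ∑ mu ∈ horizontalStrips lam,
      x (Fin.last n) ^ (lam.cells \ mu.cells).card *
        tableauSum mu.cells (fun i => x (Fin.castSucc i)) := by
  simp only [tableauSum, mul_sum]
  rw [sum_sigma']
  symm
  refine sum_bij (fun p _ => extendFilling p.1.cells p.2) ?_ ?_ ?_ ?_
  · rintro ⟨mu, T⟩ hp
    rw [mem_sigma, mem_horizontalStrips, mem_SSYT] at hp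
    rw [mem_SSYT, isSSYT_extendFilling_cells_iff hp.1.1]
    exact ⟨hp.2, hp.1.2⟩
  · rintro ⟨mu, T⟩ hp ⟨mu', T'⟩ hp' h
    rw [mem_sigma, mem_horizontalStrips] at hp hp'
    have : mu = mu' := YoungDiagram.ext (eq_of_extendFilling_eq hp.1.1 hp'.1.1 h)
    subst this
    exact congrArg _ (extendFilling_injective hp.1.1 h)
  · intro T hT
    obtain ⟨E, hE, T', rfl⟩ := exists_extendFilling_eq T
    rw [mem_SSYT] at hT
    have h := (isSSYT_extendFilling_iff hE T').1 hT
    -- Move left within the row first, then up within the column; each move uses one of the two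
    -- conditions on `E`.
    have hlow : IsLowerSet (E : Set (ℕ × ℕ)) := by
      rintro ⟨i, j⟩ ⟨i', j'⟩ hab hb
      simp only [Prod.mk_le_mk] at hab
      have hD : (i, j) ∈ lam.cells := hE hb
      have h1 : (i, j') ∈ E := by
        rcases hab.2.lt_or_eq with hlt | heq
        · exact h.2.1 (i, j') (lam.up_left_mem le_rfl hab.2 hD) (i, j) hb rfl hlt
        · rwa [heq]
      rcases hab.1.lt_or_eq with hlt | heq
      · exact h.2.2 (i', j') (lam.up_left_mem hab.1 hab.2 hD) (i, j') (hE h1) rfl hlt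
      · rwa [heq]
    have hmu : (⟨E, hlow⟩ : YoungDiagram) ≤ lam := hE
    refine ⟨⟨⟨E, hlow⟩, T'⟩, ?_, rfl⟩
    rw [mem_sigma, mem_horizontalStrips, mem_SSYT]
    have h' := (isSSYT_extendFilling_cells_iff hmu T').1 hT
    exact ⟨⟨hmu, h'.2⟩, h'.1⟩
  · rintro ⟨mu, T⟩ hp
    rw [mem_sigma, mem_horizontalStrips] at hp
    exact (prod_extendFilling hp.1.1 T x).symm

theorem le_label_of_isSSYT {n : ℕ} {lam : YoungDiagram} {T : lam.cells → Fin n}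
    (hT : IsSSYT lam.cells T) (i j : ℕ) (h : (i, j) ∈ lam.cells) : i ≤ T ⟨(i, j), h⟩ := by
  induction i with
  | zero => exact Nat.zero_le _
  | succ i ih =>
    have h' : (i, j) ∈ lam.cells := lam.up_left_mem (Nat.le_succ i) le_rfl h
    have := hT.2 ⟨(i, j), h'⟩ ⟨(i + 1, j), h⟩ rfl (Nat.lt_succ_self i)
    have := ih h'
    omega

theorem tableauSum_eq_zero {R : Type*} [CommRing R] {lam : YoungDiagram} {n : ℕ}
    (h : n < lam.colLen 0) (x : Fin n → R) : tableauSum lam.cells x = 0 := by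
  have : SSYT lam.cells n = ∅ := by
    refine eq_empty_of_forall_notMem fun T hT => ?_
    have hmem : (n, 0) ∈ lam.cells := YoungDiagram.mem_iff_lt_colLen.2 h
    have := le_label_of_isSSYT (mem_SSYT.1 hT) n 0 hmem
    omega
  rw [tableauSum, this, sum_empty]

/-! ### Standard tableaux -/

open scoped Classical in
/-- The diagrams that arise from `lam` by removing one box. -/
noncomputable def lowerCovers (lam : YoungDiagram) : Finset YoungDiagram :=
  (subdiagrams lam).filter (fun mu => mu.card + 1 = lam.card)

theorem mem_lowerCovers {lam mu : YoungDiagram} :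
    mu ∈ lowerCovers lam ↔ mu ≤ lam ∧ mu.card + 1 = lam.card := by
  simp [lowerCovers, mem_subdiagrams]

theorem card_skewCells_add {lam nu : YoungDiagram} (h : nu ≤ lam) :
    (skewCells lam nu).card + nu.card = lam.card := by
  rw [skewCells]
  exact card_sdiff_add_card_eq_card h

theorem mem_SYT {D : Finset (ℕ × ℕ)} {n : ℕ} {T : D → Fin n} :
    T ∈ SYT D n ↔ IsSSYT D T ∧ Function.Injective T ∧
      ∀ a b : D, a.1.1 = b.1.1 → a.1.2 < b.1.2 → T a < T b := by
  simp [SYT, mem_SSYT]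

theorem mem_SYT_iff {D : Finset (ℕ × ℕ)} {n : ℕ} {T : D → Fin n} :
    T ∈ SYT D n ↔ IsSSYT D T ∧ Function.Injective T := by
  rw [mem_SYT]
  refine and_congr_right fun h => and_iff_left_of_imp fun hi a b hab hab' => ?_
  refine lt_of_le_of_ne (h.1 a b hab hab') fun he => ?_
  rw [hi he] at hab'
  exact lt_irrefl _ hab'

theorem injective_extendFilling_iff {m : ℕ} {D E : Finset (ℕ × ℕ)} (hE : E ⊆ D)
    (T : E → Fin m) :
    Function.Injective (extendFilling E T : D → Fin (m + 1)) ↔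
      Function.Injective T ∧ (D \ E).card ≤ 1 := by
  rw [card_le_one]
  constructor
  · refine fun h => ⟨fun a b hab => ?_, fun a ha b hb => ?_⟩
    · have : (⟨a.1, hE a.2⟩ : D) = ⟨b.1, hE b.2⟩ := h (by
        rw [extendFilling_of_mem T ⟨a.1, hE a.2⟩ a.2, extendFilling_of_mem T ⟨b.1, hE b.2⟩ b.2, hab])
      exact Subtype.ext (congrArg (fun c : D => c.1) this)
    · rw [mem_sdiff] at ha hb
      have : (⟨a, ha.1⟩ : D) = ⟨b, hb.1⟩ := h (by
        rw [extendFilling_of_notMem T _ ha.2, extendFilling_of_notMem T _ hb.2])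
      exact congrArg Subtype.val this
  · rintro ⟨h1, h2⟩ a b hab
    by_cases ha : a.1 ∈ E
    · by_cases hb : b.1 ∈ E
      · rw [extendFilling_of_mem T _ ha, extendFilling_of_mem T _ hb] at hab
        have := congrArg Subtype.val (h1 (Fin.castSucc_injective _ hab))
        exact Subtype.ext this
      · rw [(extendFilling_eq_last_iff T b).2 hb, extendFilling_eq_last_iff] at hab
        exact absurd ha hab
    · have hb := (extendFilling_eq_last_iff T b).1 (hab ▸ (extendFilling_eq_last_iff T a).2 ha)
      exact Subtype.ext (h2 _ (mem_sdiff.2 ⟨a.2, ha⟩) _ (mem_sdiff.2 ⟨b.2, hb⟩))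

theorem skewCells_sdiff {lam mu nu : YoungDiagram} (h1 : nu ≤ mu) :
    skewCells lam nu \ skewCells mu nu = skewCells lam mu := by
  ext b
  have := @h1 b
  simp only [skewCells, mem_sdiff, YoungDiagram.mem_cells]
  tauto

theorem skewCells_subset {lam mu nu : YoungDiagram} (h : mu ≤ lam) :
    skewCells mu nu ⊆ skewCells lam nu := sdiff_subset_sdiff h (Subset.refl _)

/-- The single added box is a corner of `lam`, so the row and column conditions on the largest label
hold automatically. -/
theorem extendFilling_mem_SYT_iff {m : ℕ} {lam mu nu : YoungDiagram} (h1 : nu ≤ mu)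
    (h2 : mu ∈ lowerCovers lam) (T : skewCells mu nu → Fin m) :
    (extendFilling _ T : skewCells lam nu → Fin (m + 1)) ∈ SYT (skewCells lam nu) (m + 1) ↔
      T ∈ SYT (skewCells mu nu) m := by
  rw [mem_lowerCovers] at h2
  have hcard : (skewCells lam mu).card = 1 := by
    have := card_skewCells_add h2.1
    omega
  have hsub := skewCells_subset (nu := nu) h2.1
  rw [mem_SYT_iff, mem_SYT_iff, injective_extendFilling_iff hsub, isSSYT_extendFilling_iff hsub,
    skewCells_sdiff h1, hcard]
  have hrow : ∀ a ∈ skewCells lam nu, ∀ b ∈ skewCells mu nu, a.1 = b.1 → a.2 < b.2 →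
      a ∈ skewCells mu nu := by
    rintro ⟨i, j⟩ ha ⟨i', j'⟩ hb hab hab'
    rw [skewCells, mem_sdiff] at ha hb ⊢
    exact ⟨mu.up_left_mem (le_of_eq hab) (le_of_lt hab') hb.1, ha.2⟩
  have hcol : ∀ a ∈ skewCells lam nu, ∀ b ∈ skewCells lam nu, a.2 = b.2 → a.1 < b.1 →
      a ∈ skewCells mu nu := by
    rintro ⟨i, j⟩ ha ⟨i', j'⟩ hb hab hab'
    by_contra hna
    have hna' : (i, j) ∉ mu.cells := fun h => hna (mem_sdiff.2 ⟨h, (mem_sdiff.1 ha).2⟩)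
    have hnb' : (i', j') ∉ mu.cells := fun h =>
      hna' (mu.up_left_mem (le_of_lt hab') (le_of_eq hab) h)
    have := card_le_one.1 hcard.le _ (mem_sdiff.2 ⟨(mem_sdiff.1 ha).1, hna'⟩) _
      (mem_sdiff.2 ⟨(mem_sdiff.1 hb).1, hnb'⟩)
    simp only [Prod.mk.injEq] at this
    simp only at hab'
    omega
  tauto

open scoped Classical in
theorem card_SYT_succ {m : ℕ} {lam nu : YoungDiagram} (h : nu ≤ lam)
    (hm : (skewCells lam nu).card = m + 1) :
    (SYT (skewCells lam nu) (m + 1)).card =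
      ∑ mu ∈ lowerCovers lam with nu ≤ mu, (SYT (skewCells mu nu) m).card := by
  rw [← card_sigma]
  symm
  refine card_bij (fun p _ => extendFilling _ p.2) ?_ ?_ ?_
  · rintro ⟨mu, T⟩ hp
    rw [mem_sigma, mem_filter] at hp
    exact (extendFilling_mem_SYT_iff hp.1.2 hp.1.1 T).2 hp.2
  · rintro ⟨mu, T⟩ hp ⟨mu', T'⟩ hp' heq
    rw [mem_sigma, mem_filter, mem_lowerCovers] at hp hp'
    have hs := skewCells_subset (nu := nu) hp.1.1.1
    have hs' := skewCells_subset (nu := nu) hp'.1.1.1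
    have heq' := eq_of_extendFilling_eq hs hs' heq
    have : mu = mu' := by
      refine YoungDiagram.ext ?_
      rw [← sdiff_union_of_subset hp.1.2, ← sdiff_union_of_subset hp'.1.2]
      exact congrArg (· ∪ nu.cells) heq'
    subst this
    exact congrArg _ (extendFilling_injective hs heq)
  · intro T hT
    obtain ⟨E, hE, T', rfl⟩ := exists_extendFilling_eq T
    have hT' := mem_SYT_iff.1 hT
    rw [injective_extendFilling_iff hE, isSSYT_extendFilling_iff hE] at hT'
    obtain ⟨⟨_, hrow, hcol⟩, hinj, hcard⟩ := hT'
    have hlow : IsLowerSet ((nu.cells ∪ E : Finset (ℕ × ℕ)) : Set (ℕ × ℕ)) := by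
      rintro ⟨i, j⟩ ⟨i', j'⟩ hab hb
      simp only [Prod.mk_le_mk] at hab
      simp only [mem_coe, mem_union] at hb ⊢
      by_cases hnu : (i', j') ∈ nu.cells
      · exact Or.inl hnu
      refine Or.inr ?_
      rcases hb with hb | hb
      · exact absurd (nu.up_left_mem hab.1 hab.2 hb) hnu
      have hD := mem_sdiff.1 (hE hb)
      by_cases hnu2 : (i, j') ∈ nu.cells
      · exact absurd (nu.up_left_mem hab.1 le_rfl hnu2) hnu
      have h1 : (i, j') ∈ E := by
        rcases hab.2.lt_or_eq with hlt | heq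
        · exact hrow (i, j') (mem_sdiff.2 ⟨lam.up_left_mem le_rfl hab.2 hD.1, hnu2⟩) (i, j) hb
            rfl hlt
        · rwa [heq]
      rcases hab.1.lt_or_eq with hlt | heq
      · exact hcol (i', j') (mem_sdiff.2 ⟨lam.up_left_mem hab.1 hab.2 hD.1, hnu⟩) (i, j')
          (hE h1) rfl hlt
      · rwa [heq]
    have hdisj : Disjoint nu.cells E :=
      disjoint_left.2 fun b hb hb' => (mem_sdiff.1 (hE hb')).2 hb
    have hEeq : skewCells ⟨nu.cells ∪ E, hlow⟩ nu = E := by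
      rw [skewCells]
      exact union_sdiff_cancel_left hdisj
    -- Injectivity bounds `E.card` above by the number of labels; at most one box carries the last
    -- label, which bounds it below.
    have hEcard : E.card = m := by
      have h1 := card_sdiff_add_card_eq_card hE
      have h2 : E.card ≤ m := by simpa using Fintype.card_le_of_injective T' hinj
      omega
    have hle : (⟨nu.cells ∪ E, hlow⟩ : YoungDiagram) ≤ lam :=
      union_subset h (hE.trans sdiff_subset)
    have hge : nu ≤ (⟨nu.cells ∪ E, hlow⟩ : YoungDiagram) :=
      (subset_union_left : nu.cells ⊆ nu.cells ∪ E)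
    have hcov : (⟨nu.cells ∪ E, hlow⟩ : YoungDiagram) ∈ lowerCovers lam := by
      rw [mem_lowerCovers]
      refine ⟨hle, ?_⟩
      have h1 := card_skewCells_add h
      have h2 : (⟨nu.cells ∪ E, hlow⟩ : YoungDiagram).card = nu.card + E.card :=
        card_union_of_disjoint hdisj
      omega
    -- The domain of `T'` is `E`, which equals the skew shape only propositionally, so the filling
    -- is transported by rewriting.
    have hex : ∃ T'' : skewCells ⟨nu.cells ∪ E, hlow⟩ nu → Fin m,
        (extendFilling _ T'' : skewCells lam nu → Fin (m + 1)) = extendFilling E T' := by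
      rw [hEeq]
      exact ⟨T', rfl⟩
    obtain ⟨T'', hT''⟩ := hex
    refine ⟨⟨_, T''⟩, ?_, hT''⟩
    rw [mem_sigma, mem_filter]
    exact ⟨⟨hcov, hge⟩, (extendFilling_mem_SYT_iff hge hcov T'').1 (hT'' ▸ hT)⟩

theorem numSYT_eq_zero {lam nu : YoungDiagram} (h : ¬ nu ≤ lam) : numSYT lam nu = 0 := if_neg h

theorem numSYT_self (lam : YoungDiagram) : numSYT lam lam = 1 := by
  have h : skewCells lam lam = ∅ := Finset.sdiff_self _
  rw [numSYT, if_pos le_rfl, h, card_eq_one]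
  refine ⟨fun b => absurd b.2 (notMem_empty _), ?_⟩
  ext T
  simp only [mem_SYT_iff, mem_singleton]
  exact ⟨fun _ => funext fun b => absurd b.2 (notMem_empty _),
    fun _ => ⟨⟨fun a => absurd a.2 (notMem_empty _), fun a => absurd a.2 (notMem_empty _)⟩,
      fun a => absurd a.2 (notMem_empty _)⟩⟩

/-- The box with the largest label is removed. Containment of `nu` is not needed, since otherwise
every term is zero by convention. -/
theorem numSYT_eq_sum {lam nu : YoungDiagram} (h : nu.card < lam.card) :
    numSYT lam nu = ∑ mu ∈ lowerCovers lam, numSYT mu nu := by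
  classical
  by_cases hle : nu ≤ lam
  · have h1 := card_skewCells_add hle
    obtain ⟨m, hm⟩ : ∃ m, (skewCells lam nu).card = m + 1 :=
      ⟨(skewCells lam nu).card - 1, by omega⟩
    rw [numSYT, if_pos hle, hm, card_SYT_succ hle hm, sum_filter]
    refine sum_congr rfl fun mu hmu => ?_
    rw [numSYT]
    split_ifs with hnu
    · rw [mem_lowerCovers] at hmu
      have h2 := card_skewCells_add hnu
      rw [show (skewCells mu nu).card = m by omega]
    · rfl
  · rw [numSYT_eq_zero hle]
    symm
    refine sum_eq_zero fun mu hmu => numSYT_eq_zero fun h' => hle ?_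
    exact h'.trans (mem_lowerCovers.1 hmu).1

/-! ### Alternants and their recursion in the number of variables -/

/-- The alternant `det (x_i ^ (β j))`. -/
noncomputable def alternant {R : Type*} [CommRing R] {n : ℕ} (x : Fin n → R) (β : Fin n → ℕ) : R :=
  (Matrix.of fun i j => x i ^ β j).det

theorem alternant_apply {R : Type*} [CommRing R] {n : ℕ} (x : Fin n → R) (β : Fin n → ℕ) :
    alternant x β = ∑ σ : Equiv.Perm (Fin n), (σ.sign : ℤ) • ∏ j, x (σ j) ^ β j := by
  rw [alternant, Matrix.det_apply]
  rfl

theorem alternant_eq_zero {R : Type*} [CommRing R] {n : ℕ} (x : Fin n → R) (β : Fin n → ℕ)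
    (h : ¬ Function.Injective β) : alternant x β = 0 := by
  simp only [Function.Injective, not_forall] at h
  obtain ⟨a, b, hab, hne⟩ := h
  exact Matrix.det_zero_of_column_eq hne fun i => by simp [hab]

theorem pow_sub_pow_eq_sum_Ico {R : Type*} [CommRing R] (x y : R) {a b : ℕ} (h : a ≤ b) :
    x ^ b - y ^ (b - a) * x ^ a = (x - y) * ∑ k ∈ Ico a b, x ^ k * y ^ (b - 1 - k) := by
  induction b, h using Nat.le_induction with
  | base => simp
  | succ b hab ih =>
    rw [sum_Ico_succ_top hab, mul_add]
    have h1 : ∑ k ∈ Ico a b, x ^ k * y ^ (b + 1 - 1 - k) =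
        y * ∑ k ∈ Ico a b, x ^ k * y ^ (b - 1 - k) := by
      rw [mul_sum]
      refine sum_congr rfl fun k hk => ?_
      have := (mem_Ico.1 hk).2
      rw [show b + 1 - 1 - k = (b - 1 - k) + 1 by omega]
      ring
    rw [h1, mul_left_comm, ← ih, show b + 1 - a = (b - a) + 1 by omega]
    simp
    ring

/-- Multilinearity of the determinant in its columns. -/
theorem det_of_sum {R : Type*} [CommRing R] {n : ℕ} (x : Fin n → R) (S : Fin n → Finset ℕ)
    (w : Fin n → ℕ → R) :
    (Matrix.of fun i j => ∑ k ∈ S j, x i ^ k * w j k).det =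
      ∑ κ ∈ Fintype.piFinset S, (∏ j, w j (κ j)) * alternant x κ := by
  rw [Matrix.det_apply]
  simp only [Matrix.of_apply, prod_univ_sum, alternant_apply, mul_sum, smul_sum]
  rw [sum_comm]
  refine sum_congr rfl fun κ _ => sum_congr rfl fun σ _ => ?_
  rw [prod_mul_distrib, mul_smul_comm, mul_comm]
  rfl

/-- Column operations and expansion along the last row. -/
theorem alternant_succ {R : Type*} [CommRing R] {n : ℕ} (x : Fin (n + 1) → R)
    (β : Fin (n + 1) → ℕ) (hβ : Monotone β) :
    alternant x β = ((-1) ^ n * ∏ i : Fin n, (x i.castSucc - x (Fin.last n))) *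
      (x (Fin.last n) ^ β 0 *
        ∑ κ ∈ Fintype.piFinset (fun j : Fin n => Ico (β j.castSucc) (β j.succ)),
          (∏ j : Fin n, x (Fin.last n) ^ (β j.succ - 1 - κ j)) *
            alternant (fun i : Fin n => x i.castSucc) κ) := by
  set y := x (Fin.last n) with hy
  -- From each column after the first, the previous column is subtracted with the power of `y` that
  -- clears the last row. Only the entry `y ^ β 0` survives there.
  let B : Matrix (Fin (n + 1)) (Fin (n + 1)) R := Matrix.of fun i j =>
    Fin.cases (x i ^ β 0)
      (fun j => x i ^ β j.succ - y ^ (β j.succ - β j.castSucc) * x i ^ β j.castSucc) j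
  have h1 : alternant x β = B.det := by
    refine Matrix.det_eq_of_forall_col_eq_smul_add_pred
      (fun j : Fin n => y ^ (β j.succ - β j.castSucc)) (fun i => by simp [B]) (fun i j => ?_)
    simp [B]
  have hm : ∀ j : Fin n, β j.castSucc ≤ β j.succ := fun j => hβ (Fin.castSucc_lt_succ).le
  rw [h1, Matrix.det_succ_row B (Fin.last n), sum_eq_single 0]
  -- Every entry of row `i` of the minor is a difference of powers divisible by `x i.castSucc - y`;
  -- the quotients are geometric sums.
  · have hsub : (B.submatrix (Fin.last n).succAbove (0 : Fin (n + 1)).succAbove).det =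
        (∏ i : Fin n, (x i.castSucc - y)) *
        (Matrix.of fun i j : Fin n => ∑ k ∈ Ico (β j.castSucc) (β j.succ),
          x i.castSucc ^ k * y ^ (β j.succ - 1 - k)).det := by
      rw [← Matrix.det_mul_column]
      congr 1
      ext i j
      simp only [Matrix.submatrix_apply, Fin.succAbove_last, Fin.succAbove_zero, Matrix.of_apply, B,
        Fin.cases_succ]
      exact pow_sub_pow_eq_sum_Ico _ _ (hm j)
    rw [hsub, det_of_sum (fun i : Fin n => x i.castSucc)
      (fun j : Fin n => Ico (β j.castSucc) (β j.succ)) (fun j k => y ^ (β j.succ - 1 - k))]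
    simp only [B, Matrix.of_apply, Fin.cases_zero, Fin.val_last, Fin.val_zero, add_zero]
    rw [← hy]
    ring
  · intro j _ hj
    obtain ⟨j, rfl⟩ := Fin.exists_succ_eq.2 hj
    have : B (Fin.last n) j.succ = 0 := by
      simp only [B, Matrix.of_apply, Fin.cases_succ]
      rw [← hy, ← pow_add, Nat.sub_add_cancel (hm j), sub_self]
    rw [this]
    ring
  · simp

/-! ### Row lengths -/

/-- The lengths of the first `n` rows of `lam`, from the bottom to the top. -/
def revRowLen (n : ℕ) (lam : YoungDiagram) (j : Fin n) : ℕ := lam.rowLen (n - 1 - j)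

theorem revRowLen_monotone (n : ℕ) (lam : YoungDiagram) : Monotone (revRowLen n lam) := by
  intro a b hab
  have : (a : ℕ) ≤ b := hab
  exact lam.rowLen_anti _ _ (by omega)

theorem rowLen_eq_zero {lam : YoungDiagram} {i : ℕ} (h : lam.colLen 0 ≤ i) : lam.rowLen i = 0 := by
  by_contra hne
  have h1 : (i, 0) ∈ lam := YoungDiagram.mem_iff_lt_rowLen.2 (Nat.pos_of_ne_zero hne)
  exact absurd (YoungDiagram.mem_iff_lt_colLen.1 h1) (not_lt.2 h)

theorem le_iff_rowLen {mu lam : YoungDiagram} :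
    mu ≤ lam ↔ ∀ i, mu.rowLen i ≤ lam.rowLen i := by
  constructor
  · intro h i
    by_contra hlt
    have h1 : (i, lam.rowLen i) ∈ mu := YoungDiagram.mem_iff_lt_rowLen.2 (not_le.1 hlt)
    exact lt_irrefl _ (YoungDiagram.mem_iff_lt_rowLen.1 (h h1))
  · rintro h ⟨i, j⟩ hij
    exact YoungDiagram.mem_iff_lt_rowLen.2
      ((YoungDiagram.mem_iff_lt_rowLen.1 hij).trans_le (h i))

theorem le_iff_revRowLen {n : ℕ} {mu lam : YoungDiagram} (hmu : mu.colLen 0 ≤ n) :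
    mu ≤ lam ↔ ∀ j, revRowLen n mu j ≤ revRowLen n lam j := by
  rw [le_iff_rowLen]
  refine ⟨fun h j => h _, fun h i => ?_⟩
  by_cases hi : i < n
  · have := h ⟨n - 1 - i, by omega⟩
    simp only [revRowLen] at this
    rwa [show n - 1 - (n - 1 - i) = i by omega] at this
  · rw [rowLen_eq_zero (hmu.trans (not_lt.1 hi))]
    exact Nat.zero_le _

theorem revRowLen_injective {n : ℕ} {mu lam : YoungDiagram} (hmu : mu.colLen 0 ≤ n)
    (hlam : lam.colLen 0 ≤ n) (h : revRowLen n mu = revRowLen n lam) : mu = lam :=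
  le_antisymm ((le_iff_revRowLen hmu).2 fun j => (congrFun h j).le)
    ((le_iff_revRowLen hlam).2 fun j => (congrFun h j).ge)

theorem exists_revRowLen_eq {n : ℕ} (f : Fin n → ℕ) (hf : Monotone f) :
    ∃ mu : YoungDiagram, mu.colLen 0 ≤ n ∧ revRowLen n mu = f := by
  let S : Finset (ℕ × ℕ) := univ.biUnion fun k : Fin n =>
    (range (n - k)) ×ˢ (range (f k))
  have hS : ∀ i j, (i, j) ∈ S ↔ ∃ k : Fin n, i < n - k ∧ j < f k := by
    intro i j
    simp [S]
  let mu : YoungDiagram := ⟨S, by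
    rintro ⟨i, j⟩ ⟨i', j'⟩ hab hb
    simp only [Prod.mk_le_mk] at hab
    rw [mem_coe, hS] at hb ⊢
    obtain ⟨k, h1, h2⟩ := hb
    exact ⟨k, by omega, by omega⟩⟩
  have hmem : ∀ i j, (i, j) ∈ mu ↔ ∃ k : Fin n, i < n - k ∧ j < f k := hS
  refine ⟨mu, ?_, ?_⟩
  · by_contra hlt
    have h1 : (n, 0) ∈ mu := YoungDiagram.mem_iff_lt_colLen.2 (not_le.1 hlt)
    obtain ⟨k, h1, _⟩ := (hmem _ _).1 h1
    omega
  · funext j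
    refine eq_of_forall_lt_iff fun c => ?_
    rw [revRowLen, ← YoungDiagram.mem_iff_lt_rowLen, hmem]
    constructor
    · rintro ⟨k, h1, h2⟩
      have hkj : k ≤ j := Fin.le_def.2 (by omega)
      exact h2.trans_le (hf hkj)
    · intro h
      exact ⟨j, by omega, h⟩

theorem card_eq_sum_rowLen {n : ℕ} {mu : YoungDiagram} (hmu : mu.colLen 0 ≤ n) :
    mu.card = ∑ i ∈ range n, mu.rowLen i := by
  have : mu.cells = ((range n).sigma (fun i => range (mu.rowLen i))).map
      ⟨fun p => (p.1, p.2), fun p q h => by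
        obtain ⟨a, b⟩ := p
        obtain ⟨c, d⟩ := q
        simpa using h⟩ := by
    ext ⟨i, j⟩
    simp only [YoungDiagram.mem_cells, mem_map, mem_sigma, mem_range, Sigma.exists]
    rw [YoungDiagram.mem_iff_lt_rowLen]
    constructor
    · intro h
      refine ⟨i, j, ⟨?_, h⟩, rfl⟩
      by_contra hi
      rw [rowLen_eq_zero (hmu.trans (not_lt.1 hi))] at h
      omega
    · rintro ⟨a, b, ⟨_, h⟩, heq⟩
      cases heq
      exact h
  rw [YoungDiagram.card, this, card_map, card_sigma]
  simp

theorem card_eq_sum_revRowLen {n : ℕ} {mu : YoungDiagram} (hmu : mu.colLen 0 ≤ n) :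
    mu.card = ∑ j, revRowLen n mu j := by
  rw [card_eq_sum_rowLen hmu, ← sum_range_reflect, sum_range]
  rfl

theorem revRowLen_succ_succ (n : ℕ) (lam : YoungDiagram) (j : Fin n) :
    revRowLen (n + 1) lam j.succ = revRowLen n lam j := by
  simp only [revRowLen, Fin.val_succ]
  congr 1
  omega

/-- A horizontal strip means interlacing row lengths. Listing rows from the bottom makes them weakly
increasing, so that adding the index gives strictly increasing exponents. -/
theorem mem_horizontalStrips_iff {n : ℕ} {lam mu : YoungDiagram} (hlam : lam.colLen 0 ≤ n + 1)
    (hmu : mu.colLen 0 ≤ n) : mu ∈ horizontalStrips lam ↔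
      revRowLen n mu ∈ Fintype.piFinset (fun j : Fin n =>
        Icc (revRowLen (n + 1) lam j.castSucc) (revRowLen (n + 1) lam j.succ)) := by
  rw [mem_horizontalStrips, Fintype.mem_piFinset, le_iff_revRowLen hmu]
  have h2 : (∀ i j, (i + 1, j) ∈ lam → (i, j) ∈ mu) ↔
      ∀ j : Fin n, revRowLen (n + 1) lam j.castSucc ≤ revRowLen n mu j := by
    constructor
    · intro h j
      by_contra hlt
      have h1 : (n - 1 - j + 1, revRowLen n mu j) ∈ lam := by
        rw [YoungDiagram.mem_iff_lt_rowLen]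
        have := not_le.1 hlt
        simp only [revRowLen, Fin.val_castSucc] at this ⊢
        rwa [show n + 1 - 1 - (j : ℕ) = n - 1 - j + 1 by omega] at this
      exact lt_irrefl _ (YoungDiagram.mem_iff_lt_rowLen.1 (h _ _ h1))
    · intro h i j hij
      rw [YoungDiagram.mem_iff_lt_rowLen] at hij ⊢
      by_cases hi : i < n
      · have := h ⟨n - 1 - i, by omega⟩
        simp only [revRowLen, Fin.val_castSucc] at this
        rw [show n + 1 - 1 - (n - 1 - i) = i + 1 by omega,
          show n - 1 - (n - 1 - i) = i by omega] at this
        omega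
      · rw [rowLen_eq_zero (by omega)] at hij
        omega
  rw [h2, ← forall_and]
  refine forall_congr' fun j => ?_
  rw [mem_Icc, revRowLen_succ_succ, and_comm]

/-! ### The bialternant formula -/

/-- The branching rule in row-length coordinates. The function `F` stands for the induction
hypothesis; diagrams with more than `n` rows drop out because they have no tableaux with `n` labels.
-/
theorem tableauSum_succ' {R : Type*} [CommRing R] {lam : YoungDiagram} {n : ℕ}
    (hlam : lam.colLen 0 ≤ n + 1) (x : Fin (n + 1) → R) (a : R)
    (F : (Fin n → ℕ) → R)
    (hF : ∀ mu : YoungDiagram, mu.colLen 0 ≤ n →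
      tableauSum mu.cells (fun i : Fin n => x i.castSucc) * a = F (revRowLen n mu)) :
    tableauSum lam.cells x * a = x (Fin.last n) ^ revRowLen (n + 1) lam 0 *
      ∑ g ∈ Fintype.piFinset (fun j : Fin n =>
        Icc (revRowLen (n + 1) lam j.castSucc) (revRowLen (n + 1) lam j.succ)),
        (∏ j : Fin n, x (Fin.last n) ^ (revRowLen (n + 1) lam j.succ - g j)) * F g := by
  classical
  rw [tableauSum_succ, sum_mul, mul_sum,
    ← sum_filter_add_sum_filter_not _ (fun mu : YoungDiagram => mu.colLen 0 ≤ n)]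
  rw [sum_eq_zero (s := filter (fun mu : YoungDiagram => ¬ mu.colLen 0 ≤ n) _), add_zero]
  swap
  · intro mu hmu
    rw [tableauSum_eq_zero (not_le.1 (mem_filter.1 hmu).2)]
    ring
  refine sum_bij (fun mu _ => revRowLen n mu) ?_ ?_ ?_ ?_
  · intro mu hmu
    rw [mem_filter] at hmu
    exact (mem_horizontalStrips_iff hlam hmu.2).1 hmu.1
  · intro mu hmu mu' hmu' h
    exact revRowLen_injective (mem_filter.1 hmu).2 (mem_filter.1 hmu').2 h
  · intro g hg
    -- Consecutive intervals share an endpoint, so any choice of points in them is weakly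
    -- increasing.
    have hmono : Monotone g := by
      rcases n with _ | n
      · exact fun a => a.elim0
      · rw [Fin.monotone_iff_le_succ]
        intro i
        rw [Fintype.mem_piFinset] at hg
        have h1 := (mem_Icc.1 (hg i.castSucc)).2
        have h2 := (mem_Icc.1 (hg i.succ)).1
        rw [Fin.succ_castSucc] at h1
        exact h1.trans h2
    obtain ⟨mu, hmu, rfl⟩ := exists_revRowLen_eq g hmono
    exact ⟨mu, mem_filter.2 ⟨(mem_horizontalStrips_iff hlam hmu).2 hg, hmu⟩, rfl⟩
  · intro mu hmu
    rw [mem_filter] at hmu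
    have hle := (mem_horizontalStrips.1 hmu.1).1
    rw [mul_assoc, hF mu hmu.2, ← mul_assoc]
    congr 1
    rw [prod_pow_eq_pow_sum, ← pow_add]
    congr 1
    have h1 : (lam.cells \ mu.cells).card + mu.card = lam.card := card_skewCells_add hle
    rw [card_eq_sum_revRowLen hmu.2, card_eq_sum_revRowLen hlam, Fin.sum_univ_succ] at h1
    have h2 : ∑ j : Fin n, (revRowLen (n + 1) lam j.succ - revRowLen n mu j) +
        ∑ j, revRowLen n mu j = ∑ j : Fin n, revRowLen (n + 1) lam j.succ := by
      rw [← sum_add_distrib]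
      refine sum_congr rfl fun j _ => Nat.sub_add_cancel ?_
      rw [revRowLen_succ_succ]
      exact (le_iff_revRowLen hmu.2).1 hle j
    omega

theorem monotone_add_val {n : ℕ} {f : Fin n → ℕ} (hf : Monotone f) :
    StrictMono (fun j : Fin n => f j + j) := by
  intro a b hab
  have h1 := hf hab.le
  have h2 : (a : ℕ) < b := hab
  simp only
  omega

theorem alternant_val_succ {R : Type*} [CommRing R] {n : ℕ} (x : Fin (n + 1) → R) :
    alternant x (fun j => (j : ℕ)) =
      ((-1) ^ n * ∏ i : Fin n, (x i.castSucc - x (Fin.last n))) *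
        alternant (fun i : Fin n => x i.castSucc) (fun j => (j : ℕ)) := by
  rw [alternant_succ x _ (fun a b h => h)]
  have : Fintype.piFinset (fun j : Fin n => Ico (j.castSucc : ℕ) (j.succ : ℕ)) =
      {fun j : Fin n => (j : ℕ)} := by
    ext κ
    rw [Fintype.mem_piFinset, mem_singleton, funext_iff]
    refine forall_congr' fun j => ?_
    simp only [Fin.val_castSucc, Fin.val_succ, mem_Ico]
    omega
  rw [this, sum_singleton]
  simp

/-- The bialternant formula. -/
theorem tableauSum_mul_alternant {R : Type*} [CommRing R] {n : ℕ} {lam : YoungDiagram}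
    (hlam : lam.colLen 0 ≤ n) (x : Fin n → R) :
    tableauSum lam.cells x * alternant x (fun j => (j : ℕ)) =
      alternant x (fun j => revRowLen n lam j + j) := by
  induction n generalizing lam with
  | zero =>
    have : lam.cells = ∅ := by
      refine eq_empty_of_forall_notMem ?_
      rintro ⟨i, j⟩ h
      have h0 : (i, 0) ∈ lam := lam.up_left_mem le_rfl (Nat.zero_le j) h
      have := YoungDiagram.mem_iff_lt_colLen.1 h0
      omega
    rw [this, tableauSum_empty]
    simp [alternant]
  | succ n ih =>
    have hmono := revRowLen_monotone (n + 1) lam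
    rw [alternant_val_succ, mul_left_comm,
      tableauSum_succ' hlam x _ (fun g => alternant (fun i : Fin n => x i.castSucc) fun j => g j + j)
        (fun mu hmu => ih hmu (fun i : Fin n => x i.castSucc)),
      alternant_succ x _ (monotone_add_val hmono).monotone]
    congr 2
    -- Adding `j` to `g j` shifts the lower endpoint by `j` and the upper one by `j + 1`, which
    -- turns the closed intervals of the branching rule into the half-open ones of `alternant_succ`.
    refine sum_nbij' (fun g j => g j + j) (fun κ j => κ j - j) ?_ ?_ ?_ ?_ ?_
    · intro g hg
      rw [Fintype.mem_piFinset] at hg ⊢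
      intro j
      have := mem_Icc.1 (hg j)
      simp only [mem_Ico, Fin.val_castSucc, Fin.val_succ]
      omega
    · intro g hg
      rw [Fintype.mem_piFinset] at hg ⊢
      intro j
      have := mem_Ico.1 (hg j)
      simp only [Fin.val_castSucc, Fin.val_succ] at this
      rw [mem_Icc]
      omega
    · intro g _
      funext j
      simp
    · intro g hg
      rw [Fintype.mem_piFinset] at hg
      funext j
      have := mem_Ico.1 (hg j)
      simp only [Fin.val_castSucc, Fin.val_succ] at this ⊢
      omega
    · intro g hg
      congr 1
      refine prod_congr rfl fun j _ => ?_
      congr 1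
      simp only [Fin.val_succ]
      omega

/-! ### Raising and lowering exponents of alternants -/

/-- In the term of `σ` the sum of the variables is reindexed by `σ`; the factor `x (σ j)` then
raises exponent `j`. -/
theorem sum_mul_alternant {R : Type*} [CommRing R] {n : ℕ} (x : Fin n → R) (β : Fin n → ℕ) :
    (∑ i, x i) * alternant x β = ∑ j, alternant x (β + Pi.single j 1) := by
  simp only [alternant_apply, mul_sum]
  rw [sum_comm]
  refine sum_congr rfl fun σ _ => ?_
  rw [← smul_sum, mul_smul_comm, ← Equiv.sum_comp σ x, sum_mul]
  congr 1
  refine sum_congr rfl fun j _ => ?_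
  rw [← Fintype.prod_ite_eq' j (fun k => x (σ k)), ← prod_mul_distrib]
  refine prod_congr rfl fun k _ => ?_
  by_cases h : k = j
  · subst h
    simp
    ring
  · simp [h]

theorem Derivation.map_finset_prod {R A ι : Type*} [CommRing R] [CommRing A] [Algebra R A]
    [DecidableEq ι] (D : Derivation R A A) (s : Finset ι) (f : ι → A) :
    D (∏ i ∈ s, f i) = ∑ j ∈ s, (∏ i ∈ s.erase j, f i) * D (f j) := by
  induction s using Finset.induction_on with
  | empty => simp
  | insert a s ha ih =>
    rw [prod_insert ha, D.leibniz, ih, sum_insert ha, erase_insert ha, smul_eq_mul, smul_eq_mul,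
      mul_sum, add_comm]
    congr 1
    refine sum_congr rfl fun j hj => ?_
    rw [erase_insert_of_ne (ne_of_mem_of_not_mem hj ha).symm,
      prod_insert (fun h => ha (mem_of_mem_erase h)), mul_assoc]

/-- Leibniz rule in each term. The truncated subtraction at `β j = 0` is harmless because its
coefficient vanishes. -/
theorem derivation_alternant {R A : Type*} [CommRing R] [CommRing A] [Algebra R A]
    (D : Derivation R A A) {n : ℕ} (x : Fin n → A) (hx : ∀ i, D (x i) = 1) (β : Fin n → ℕ) :
    D (alternant x β) = ∑ j, (β j : A) * alternant x (β - Pi.single j 1) := by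
  simp only [alternant_apply, mul_sum, map_sum]
  rw [sum_comm]
  refine sum_congr rfl fun σ _ => ?_
  rw [map_zsmul, D.map_finset_prod, smul_sum]
  refine sum_congr rfl fun j _ => ?_
  rw [mul_smul_comm]
  congr 1
  rw [D.leibniz_pow, hx, ← mul_prod_erase univ _ (mem_univ j)]
  have : ∏ i ∈ univ.erase j, x (σ i) ^ (β - Pi.single j 1 : Fin n → ℕ) i = ∏ i ∈ univ.erase j, x (σ i) ^ β i := by
    refine prod_congr rfl fun i hi => ?_
    simp [(mem_erase.1 hi).1]
  rw [this]
  simp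
  ring

theorem monotone_add_val_iff {n : ℕ} {g : Fin n → ℕ} :
    Monotone g ↔ StrictMono (fun j : Fin n => g j + j) := by
  refine ⟨monotone_add_val, fun h => ?_⟩
  rcases n with _ | n
  · exact fun a => a.elim0
  · rw [Fin.monotone_iff_le_succ]
    intro i
    have := h (Fin.castSucc_lt_succ (i := i))
    simp only [Fin.val_castSucc, Fin.val_succ] at this
    omega

theorem val_le_of_strictMono {n : ℕ} {γ : Fin n → ℕ} (hγ : StrictMono γ) (k : Fin n) :
    (k : ℕ) ≤ γ k := by
  obtain ⟨k, hk⟩ := k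
  induction k with
  | zero => exact Nat.zero_le _
  | succ k ih =>
    have h1 := ih (by omega)
    have h2 : γ ⟨k, by omega⟩ < γ ⟨k + 1, hk⟩ := hγ (Fin.lt_def.2 (Nat.lt_succ_self k))
    simp only at h1 ⊢
    omega

theorem colLen_le_of_le {mu lam : YoungDiagram} (h : mu ≤ lam) (j : ℕ) :
    mu.colLen j ≤ lam.colLen j := by
  by_contra hlt
  have h1 : (lam.colLen j, j) ∈ mu := YoungDiagram.mem_iff_lt_colLen.2 (not_le.1 hlt)
  exact lt_irrefl _ (YoungDiagram.mem_iff_lt_colLen.1 (h h1))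

theorem mem_lowerCovers_iff {n : ℕ} {lam mu : YoungDiagram} (hlam : lam.colLen 0 ≤ n)
    (hmu : mu.colLen 0 ≤ n) :
    mu ∈ lowerCovers lam ↔ ∃ j, revRowLen n lam = revRowLen n mu + Pi.single j 1 := by
  rw [mem_lowerCovers, le_iff_revRowLen hmu, card_eq_sum_revRowLen hlam,
    card_eq_sum_revRowLen hmu]
  have hs : ∀ j : Fin n, ∑ k, (revRowLen n mu + Pi.single j 1 : Fin n → ℕ) k =
      ∑ k, revRowLen n mu k + 1 := fun j => by
    simp [sum_add_distrib]
  constructor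
  · rintro ⟨hle, hcard⟩
    have : ∃ j, revRowLen n mu j < revRowLen n lam j := by
      by_contra hall
      push Not at hall
      have := sum_le_sum fun j (_ : j ∈ univ) => hall j
      omega
    obtain ⟨j, hj⟩ := this
    refine ⟨j, funext fun k => ?_⟩
    have hle' : ∀ k ∈ univ, (revRowLen n mu + Pi.single j 1 : Fin n → ℕ) k ≤ revRowLen n lam k := by
      intro k _
      by_cases hk : k = j
      · subst hk
        simpa using hj
      · simpa [hk] using hle k
    exact ((sum_eq_sum_iff_of_le hle').1 (by rw [hs, hcard]) k (mem_univ k)).symm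
  · rintro ⟨j, hj⟩
    rw [hj, hs]
    exact ⟨fun k => by simp, rfl⟩

/-! ### Pieri's rule and the derivative of a Schur polynomial -/

theorem finite_diagramsOfCard (m : ℕ) : {mu : YoungDiagram | mu.card = m}.Finite := by
  refine Set.Finite.of_finite_image (f := YoungDiagram.cells)
    (Set.Finite.subset ((range m ×ˢ range m).powerset.finite_toSet) ?_)
    fun a _ b _ h => YoungDiagram.ext h
  rintro _ ⟨mu, rfl, rfl⟩
  rw [mem_coe, mem_powerset]
  rintro ⟨i, j⟩ hij
  rw [mem_product, mem_range, mem_range]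
  constructor
  · have := card_le_card_of_injOn (s := range (i + 1)) (t := mu.cells) (fun k => (k, j))
      (fun k hk => mu.up_left_mem (Nat.lt_succ_iff.1 (mem_range.1 hk)) le_rfl hij)
      (fun a _ b _ h => (Prod.mk.inj h).1)
    simpa using this
  · have := card_le_card_of_injOn (s := range (j + 1)) (t := mu.cells) (fun k => (i, k))
      (fun k hk => mu.up_left_mem le_rfl (Nat.lt_succ_iff.1 (mem_range.1 hk)) hij)
      (fun a _ b _ h => (Prod.mk.inj h).2)
    simpa using this

/-- The finite set of all diagrams with `m` boxes. -/
noncomputable def diagramsOfCard (m : ℕ) : Finset YoungDiagram :=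
  (finite_diagramsOfCard m).toFinset

theorem mem_diagramsOfCard {m : ℕ} {mu : YoungDiagram} : mu ∈ diagramsOfCard m ↔ mu.card = m := by
  simp [diagramsOfCard]

theorem schur_eq_tableauSum (n : ℕ) (lam : YoungDiagram) :
    schur n lam = tableauSum lam.cells MvPolynomial.X := rfl

theorem schur_mul_alternant {n : ℕ} {lam : YoungDiagram} (hlam : lam.colLen 0 ≤ n) :
    schur n lam * alternant MvPolynomial.X (fun j : Fin n => (j : ℕ)) =
      alternant MvPolynomial.X (fun j => revRowLen n lam j + j) :=
  tableauSum_mul_alternant hlam MvPolynomial.X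

theorem schur_eq_zero {n : ℕ} {lam : YoungDiagram} (h : n < lam.colLen 0) : schur n lam = 0 :=
  tableauSum_eq_zero h _

theorem alternant_X_ne_zero (n : ℕ) :
    alternant (MvPolynomial.X : Fin n → MvPolynomial (Fin n) ℂ) (fun j : Fin n => (j : ℕ)) ≠ 0 :=
  Matrix.det_vandermonde_ne_zero_iff.2 (MvPolynomial.X_injective)

open scoped Classical in
/-- Pieri's rule for multiplication by `s_(1)`. -/
theorem sum_X_mul_schur (n : ℕ) (nu : YoungDiagram) :
    (∑ i : Fin n, MvPolynomial.X i) * schur n nu =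
      ∑ mu ∈ diagramsOfCard (nu.card + 1), if nu ≤ mu then schur n mu else 0 := by
  by_cases hnu : nu.colLen 0 ≤ n
  swap
  · rw [schur_eq_zero (not_le.1 hnu), mul_zero]
    symm
    refine sum_eq_zero fun mu _ => ?_
    split_ifs with h
    · exact schur_eq_zero ((not_le.1 hnu).trans_le (colLen_le_of_le h 0))
    · rfl
  refine mul_right_cancel₀ (alternant_X_ne_zero n) ?_
  rw [mul_assoc, schur_mul_alternant hnu, sum_mul_alternant, sum_mul]
  have hmono := revRowLen_monotone n nu
  have hstrict := monotone_add_val hmono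
  choose F hF1 hF2 using fun (f : Fin n → ℕ) (hf : Monotone f) => exists_revRowLen_eq f hf
  -- Only rows that can be lengthened within a partition survive on the left, only diagrams with at
  -- most `n` rows on the right; these correspond by adding a box.
  rw [← sum_filter_of_ne (p := fun j => Monotone (revRowLen n nu + Pi.single j 1)),
    ← sum_filter_of_ne (s := diagramsOfCard (nu.card + 1))
      (p := fun mu => mu.colLen 0 ≤ n ∧ nu ≤ mu)]
  · refine sum_bij (fun j hj => F _ (mem_filter.1 hj).2) ?_ ?_ ?_ ?_
    · intro j hj
      have hj' := (mem_filter.1 hj).2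
      have h1 : nu ∈ lowerCovers (F _ hj') :=
        (mem_lowerCovers_iff (hF1 _ hj') hnu).2 ⟨j, hF2 _ hj'⟩
      rw [mem_lowerCovers] at h1
      rw [mem_filter, mem_diagramsOfCard]
      exact ⟨h1.2.symm, hF1 _ hj', h1.1⟩
    · intro j hj j' hj' h
      have h2 := (hF2 _ (mem_filter.1 hj).2).symm.trans
        ((congrArg (revRowLen n) h).trans (hF2 _ (mem_filter.1 hj').2))
      have h3 := congrFun (add_left_cancel h2) j
      by_contra hne
      simp [hne] at h3
    · intro mu hmu
      rw [mem_filter, mem_diagramsOfCard] at hmu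
      obtain ⟨j, hj⟩ := (mem_lowerCovers_iff hmu.2.1 hnu).1
        (mem_lowerCovers.2 ⟨hmu.2.2, hmu.1.symm⟩)
      have hm : Monotone (revRowLen n nu + Pi.single j 1) := hj ▸ revRowLen_monotone n mu
      exact ⟨j, mem_filter.2 ⟨mem_univ _, hm⟩,
        revRowLen_injective (hF1 _ hm) hmu.2.1 ((hF2 _ hm).trans hj.symm)⟩
    · intro j hj
      have hj' := (mem_filter.1 hj).2
      have h1 : nu ∈ lowerCovers (F _ hj') :=
        (mem_lowerCovers_iff (hF1 _ hj') hnu).2 ⟨j, hF2 _ hj'⟩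
      rw [if_pos (mem_lowerCovers.1 h1).1, schur_mul_alternant (hF1 _ hj'), hF2]
      congr 1
      funext k
      simp only [Pi.add_apply]
      ring
  · intro mu _ h
    split_ifs at h with hle
    · refine ⟨?_, hle⟩
      by_contra hc
      rw [schur_eq_zero (not_le.1 hc), zero_mul] at h
      exact h rfl
    · simp at h
  · intro j _ h
    by_contra hnm
    refine h (alternant_eq_zero _ _ fun hinj => hnm ?_)
    rw [monotone_add_val_iff]
    -- Raising one entry of a strictly increasing sequence keeps it weakly increasing, so
    -- injectivity makes it strict again.
    have hm : Monotone ((fun j : Fin n => revRowLen n nu j + j) + Pi.single j 1) := by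
      intro a b hab
      rcases hab.lt_or_eq with hlt | rfl
      · have h1 : revRowLen n nu a + a < revRowLen n nu b + b := hstrict hlt
        have h2 : (Pi.single j 1 : Fin n → ℕ) a ≤ 1 := by
          rw [Pi.single_apply]
          split_ifs <;> omega
        simp only [Pi.add_apply]
        omega
      · exact le_rfl
    have hs := hm.strictMono_of_injective hinj
    have he : (fun k : Fin n => (revRowLen n nu + Pi.single j 1 : Fin n → ℕ) k + k) =
        (fun j : Fin n => revRowLen n nu j + j) + Pi.single j 1 := by
      funext k
      simp only [Pi.add_apply]
      ring
    rwa [he]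

/-- The added box has zero-based row `n - 1 - j` and is the last in its row, so its factor `n - r +
c` is exactly the alternant exponent that `D` brings down. -/
theorem contentProd_of_revRowLen {n : ℕ} {lam mu : YoungDiagram} (hlam : lam.colLen 0 ≤ n)
    (hmu : mu.colLen 0 ≤ n) {j : Fin n} (h : revRowLen n lam = revRowLen n mu + Pi.single j 1) :
    contentProd n lam mu = (revRowLen n lam j + j : ℕ) := by
  have hcov := mem_lowerCovers.1 ((mem_lowerCovers_iff hlam hmu).2 ⟨j, h⟩)
  have hcard : (skewCells lam mu).card = 1 := by
    have := card_skewCells_add hcov.1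
    omega
  have hj : revRowLen n lam j = revRowLen n mu j + 1 := by simp [h]
  have hmem : (n - 1 - (j : ℕ), revRowLen n mu j) ∈ skewCells lam mu := by
    rw [skewCells, mem_sdiff, YoungDiagram.mem_cells, YoungDiagram.mem_cells,
      YoungDiagram.mem_iff_lt_rowLen, YoungDiagram.mem_iff_lt_rowLen]
    simp only [revRowLen] at hj ⊢
    omega
  obtain ⟨b, hb⟩ := card_eq_one.1 hcard
  have hbeq : (n - 1 - (j : ℕ), revRowLen n mu j) = b := by
    rw [hb, mem_singleton] at hmem
    exact hmem
  rw [contentProd, hb, prod_singleton, ← hbeq, hj]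
  have : ((n - 1 - (j : ℕ) : ℕ) : ℂ) + 1 + j = n := by
    exact_mod_cast (by omega : n - 1 - (j : ℕ) + 1 + j = n)
  rw [← this]
  push_cast
  ring

/-- The derivation `∂/∂x_1 + ⋯ + ∂/∂x_n`. -/
noncomputable def gradSum (n : ℕ) :
    Derivation ℂ (MvPolynomial (Fin n) ℂ) (MvPolynomial (Fin n) ℂ) :=
  MvPolynomial.mkDerivation ℂ (fun _ => 1)

theorem gradSum_X (n : ℕ) (i : Fin n) : gradSum n (MvPolynomial.X i) = 1 :=
  MvPolynomial.mkDerivation_X ℂ _ i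

theorem strictMono_sub_single_of_ne_zero {R : Type*} [CommRing R] {n : ℕ} (x : Fin n → R)
    {β : Fin n → ℕ} (hβ : StrictMono β) (j : Fin n)
    (h : (β j : R) * alternant x (β - Pi.single j 1) ≠ 0) :
    StrictMono (β - Pi.single j 1) ∧ β = (β - Pi.single j 1) + Pi.single j 1 := by
  have hpos : β j ≠ 0 := by
    intro h0
    simp [h0] at h
  have hinj : Function.Injective (β - Pi.single j 1) := by
    by_contra hinj
    rw [alternant_eq_zero _ _ hinj, mul_zero] at h
    exact h rfl
  refine ⟨Monotone.strictMono_of_injective ?_ hinj, ?_⟩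
  · intro a b hab
    rcases hab.lt_or_eq with hlt | rfl
    · have h1 : β a < β b := hβ hlt
      have h2 : (Pi.single j 1 : Fin n → ℕ) b ≤ 1 := by
        rw [Pi.single_apply]
        split_ifs <;> omega
      simp only [Pi.sub_apply]
      omega
    · exact le_rfl
  · funext k
    by_cases hk : k = j
    · subst hk
      simp
      omega
    · simp [hk]

/-- Lowering an exponent in `0, 1, …, n - 1` either repeats the preceding one or has coefficient
zero. -/
theorem gradSum_alternant_val (n : ℕ) :
    gradSum n (alternant MvPolynomial.X (fun j : Fin n => (j : ℕ))) = 0 := by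
  rw [derivation_alternant _ _ (gradSum_X n)]
  refine sum_eq_zero fun j _ => ?_
  by_contra h
  have h1 := strictMono_sub_single_of_ne_zero _ (fun a b h => h) j h
  have h2 := val_le_of_strictMono h1.1 j
  have h3 := congrFun h1.2 j
  simp only [Pi.add_apply, Pi.single_eq_same] at h2 h3
  omega

/-- Differentiate the bialternant formula: the Vandermonde factor is constant for `D`, and a nonzero
lowered alternant corresponds to removing the last box of a row. -/
theorem gradSum_schur {n : ℕ} {lam : YoungDiagram} (hlam : lam.colLen 0 ≤ n) :
    gradSum n (schur n lam) = ∑ mu ∈ lowerCovers lam, contentProd n lam mu • schur n mu := by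
  classical
  refine mul_right_cancel₀ (alternant_X_ne_zero n) ?_
  have hD := (gradSum n).leibniz (schur n lam)
    (alternant MvPolynomial.X (fun j : Fin n => (j : ℕ)))
  rw [gradSum_alternant_val, smul_zero, zero_add, schur_mul_alternant hlam,
    derivation_alternant _ _ (gradSum_X n), smul_eq_mul, mul_comm _ (gradSum n _)] at hD
  rw [← hD, sum_mul]
  have hstrict := monotone_add_val (revRowLen_monotone n lam)
  choose F hF1 hF2 using fun (f : Fin n → ℕ) (hf : Monotone f) => exists_revRowLen_eq f hf
  symm
  have hex : ∀ mu ∈ lowerCovers lam, mu.colLen 0 ≤ n ∧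
      ∃ j, revRowLen n lam = revRowLen n mu + Pi.single j 1 := by
    intro mu hmu
    have h1 := (colLen_le_of_le (mem_lowerCovers.1 hmu).1 0).trans hlam
    exact ⟨h1, (mem_lowerCovers_iff hlam h1).1 hmu⟩
  choose hrow J hJ using hex
  refine sum_bij_ne_zero (fun mu hmu _ => J mu hmu) (fun _ _ _ => mem_univ _) ?_ ?_ ?_
  · intro mu hmu _ mu' hmu' _ h
    have h1 := hJ mu hmu
    rw [hJ mu' hmu', h] at h1
    exact revRowLen_injective (hrow mu hmu) (hrow mu' hmu') (add_right_cancel h1).symm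
  · intro j _ h
    obtain ⟨h1, h2⟩ := strictMono_sub_single_of_ne_zero _ hstrict j h
    set γ := (fun j : Fin n => revRowLen n lam j + j) - Pi.single j 1 with hγ
    have hle := val_le_of_strictMono h1
    have hg : Monotone (fun k => γ k - k) := by
      rw [monotone_add_val_iff]
      convert h1 using 2 with k
      exact Nat.sub_add_cancel (hle k)
    have hlg : revRowLen n lam = (fun k => γ k - (k : ℕ)) + Pi.single j 1 := by
      funext k
      have h3 := congrFun h2 k
      have h4 := hle k
      simp only [Pi.add_apply] at h3 ⊢
      omega
    have hmu : F _ hg ∈ lowerCovers lam :=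
      (mem_lowerCovers_iff hlam (hF1 _ hg)).2 ⟨j, by rw [hF2, hlg]⟩
    have hjj : J _ hmu = j := by
      have h5 := hJ _ hmu
      rw [hF2, hlg] at h5
      have h3 := congrFun (add_left_cancel h5) j
      by_contra hne
      simp [Ne.symm hne] at h3
    refine ⟨F _ hg, hmu, ?_, hjj⟩
    rw [contentProd_of_revRowLen hlam (hF1 _ hg) (j := j) (by rw [hF2, hlg]),
      smul_mul_assoc, schur_mul_alternant (hF1 _ hg), hF2, MvPolynomial.smul_eq_C_mul]
    convert h using 2
    · simp
    · congr 1
      funext k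
      exact Nat.sub_add_cancel (hle k)
  · intro mu hmu _
    rw [contentProd_of_revRowLen hlam (hrow mu hmu) (hJ mu hmu),
      smul_mul_assoc, schur_mul_alternant (hrow mu hmu), MvPolynomial.smul_eq_C_mul]
    rw [map_natCast]
    congr 2
    · funext k
      have := congrFun (hJ mu hmu) k
      simp only [Pi.add_apply, Pi.sub_apply] at this ⊢
      omega

/-! ### Linear independence -/

/-- A permuted strictly increasing sequence is strictly increasing only for the identity
permutation. -/
theorem coeff_alternant {n : ℕ} {β γ : Fin n → ℕ} (hβ : StrictMono β) (hγ : StrictMono γ) :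
    (alternant (MvPolynomial.X : Fin n → MvPolynomial (Fin n) ℂ) β).coeff
      (Finsupp.equivFunOnFinite.symm γ) = if β = γ then 1 else 0 := by
  classical
  have hterm : ∀ σ : Equiv.Perm (Fin n),
      (∏ j, (MvPolynomial.X (σ j) : MvPolynomial (Fin n) ℂ) ^ β j).coeff
        (Finsupp.equivFunOnFinite.symm γ) = if σ = 1 ∧ β = γ then 1 else 0 := by
    intro σ
    have h1 : ∏ j, (MvPolynomial.X (σ j) : MvPolynomial (Fin n) ℂ) ^ β j =
        MvPolynomial.monomial (Finsupp.equivFunOnFinite.symm (β ∘ σ.symm)) 1 := by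
      rw [MvPolynomial.monomial_eq, Finsupp.prod_fintype _ _ (fun i => pow_zero _),
        ← Equiv.prod_comp σ (fun i => MvPolynomial.X i ^ _)]
      simp
    rw [h1, MvPolynomial.coeff_monomial]
    refine if_congr ?_ rfl rfl
    rw [Equiv.apply_eq_iff_eq]
    constructor
    · intro h
      have hβγ : β = γ := by
        rw [← hβ.range_inj hγ, ← h, σ.symm.surjective.range_comp]
      refine ⟨?_, hβγ⟩
      subst hβγ
      ext i
      have := hβ.injective (congrFun h (σ i))
      simp only [Equiv.symm_apply_apply] at this
      simp [← this]
    · rintro ⟨rfl, rfl⟩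
      rfl
  rw [alternant_apply, MvPolynomial.coeff_sum]
  simp only [MvPolynomial.coeff_smul, hterm]
  rw [sum_eq_single 1]
  · simp
  · intro σ _ hσ
    simp [hσ]
  · simp

theorem linearIndependent_schur (n : ℕ) :
    LinearIndependent ℂ (fun mu : Par n => schur n mu.1) := by
  rw [linearIndependent_iff]
  intro c hc
  ext lam
  have h1 : c.sum (fun mu a => a • alternant
      (MvPolynomial.X : Fin n → MvPolynomial (Fin n) ℂ) (fun j => revRowLen n mu.1 j + j)) = 0 := by
    have h2 := congrArg
      (· * alternant (MvPolynomial.X : Fin n → MvPolynomial (Fin n) ℂ) (fun j => (j : ℕ))) hc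
    simp only [zero_mul, Finsupp.linearCombination_apply, Finsupp.sum, sum_mul] at h2
    rw [Finsupp.sum, ← h2]
    refine sum_congr rfl fun mu _ => ?_
    rw [smul_mul_assoc, schur_mul_alternant mu.2]
  have h3 := congrArg (MvPolynomial.coeff
    (Finsupp.equivFunOnFinite.symm (fun j => revRowLen n lam.1 j + (j : ℕ)))) h1
  rw [Finsupp.sum, MvPolynomial.coeff_sum, sum_eq_single lam] at h3
  · rw [MvPolynomial.coeff_smul, coeff_alternant (monotone_add_val (revRowLen_monotone _ _))
      (monotone_add_val (revRowLen_monotone _ _)), if_pos rfl] at h3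
    simpa using h3
  · intro mu _ hne
    rw [MvPolynomial.coeff_smul, coeff_alternant (monotone_add_val (revRowLen_monotone _ _))
      (monotone_add_val (revRowLen_monotone _ _)), if_neg, smul_zero]
    intro heq
    refine hne (Subtype.ext (revRowLen_injective mu.2 lam.2 (funext fun j => ?_)))
    exact Nat.add_right_cancel (congrFun heq j)
  · intro hlam
    rw [Finsupp.notMem_support_iff.1 hlam, zero_smul, MvPolynomial.coeff_zero]

theorem eq_bot_of_cells_eq_empty {lam : YoungDiagram} (h : lam.cells = ∅) : lam = ⊥ :=
  YoungDiagram.ext (by rw [h, YoungDiagram.cells_bot])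

theorem card_bot_diagram : (⊥ : YoungDiagram).card = 0 := by
  simp [YoungDiagram.card]

theorem card_mono_diagram {mu lam : YoungDiagram} (h : mu ≤ lam) : mu.card ≤ lam.card :=
  card_le_card h

theorem eq_of_le_of_card_le {mu lam : YoungDiagram} (h : mu ≤ lam) (hc : lam.card ≤ mu.card) :
    mu = lam := YoungDiagram.ext (eq_of_subset_of_card_le h hc)

theorem oneBox_cells : oneBox.cells = {(0, 0)} := by
  decide

theorem diagramsOfCard_one : diagramsOfCard 1 = {oneBox} := by
  ext mu
  rw [mem_diagramsOfCard, mem_singleton]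
  constructor
  · intro h
    obtain ⟨b, hb⟩ := card_eq_one.1 h
    have hmem : b ∈ mu := by
      rw [← YoungDiagram.mem_cells, hb]
      exact mem_singleton_self b
    have h0 : (0, 0) ∈ mu.cells := mu.up_left_mem (Nat.zero_le b.1) (Nat.zero_le b.2) hmem
    refine YoungDiagram.ext ?_
    rw [hb, mem_singleton] at h0
    rw [hb, oneBox_cells, h0]
  · rintro rfl
    rw [YoungDiagram.card, oneBox_cells, card_singleton]

theorem schur_bot (n : ℕ) : schur n ⊥ = 1 := by
  rw [schur_eq_tableauSum, YoungDiagram.cells_bot, tableauSum_empty]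

theorem schur_oneBox (n : ℕ) : schur n oneBox = ∑ i : Fin n, MvPolynomial.X i := by
  have h := sum_X_mul_schur n ⊥
  rw [schur_bot, mul_one, card_bot_diagram, diagramsOfCard_one, sum_singleton, if_pos bot_le] at h
  exact h.symm

theorem aeval_schur {A : Type*} [CommRing A] [Algebra ℂ A] {n : ℕ} (x : Fin n → A)
    (lam : YoungDiagram) : MvPolynomial.aeval x (schur n lam) = tableauSum lam.cells x := by
  simp [schur, tableauSum, map_sum, map_prod]

theorem aeval_neg_schur (n : ℕ) (lam : YoungDiagram) :
    MvPolynomial.aeval (fun i : Fin n => -(MvPolynomial.X i : MvPolynomial (Fin n) ℂ))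
      (schur n lam) = (-1 : ℂ) ^ lam.card • schur n lam := by
  rw [aeval_schur, schur, tableauSum, smul_sum]
  refine sum_congr rfl fun T _ => ?_
  rw [prod_neg, MvPolynomial.smul_eq_C_mul]
  simp [YoungDiagram.card]

/-! ### Taylor expansion -/

/-- The coefficient of `s_nu(x)` in `s_lam(t - x)`, up to the power of `t`. -/
noncomputable def shiftCoeff (n : ℕ) (lam nu : YoungDiagram) : ℂ :=
  (-1 : ℂ) ^ nu.card * (numSYT lam nu : ℂ) *
    (contentProd n lam nu / ((skewCells lam nu).card.factorial : ℂ))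

theorem contentProd_mul {lam mu nu : YoungDiagram} (n : ℕ) (h1 : nu ≤ mu) (h2 : mu ≤ lam) :
    contentProd n lam mu * contentProd n mu nu = contentProd n lam nu := by
  rw [contentProd, contentProd, contentProd, ← prod_sdiff (skewCells_subset (nu := nu) h2),
    skewCells_sdiff h1]

theorem contentProd_self (n : ℕ) (lam : YoungDiagram) : contentProd n lam lam = 1 := by
  simp [contentProd, skewCells]

theorem shiftCoeff_eq_zero (n : ℕ) {lam nu : YoungDiagram} (h : ¬ nu ≤ lam) :
    shiftCoeff n lam nu = 0 := by
  simp [shiftCoeff, numSYT_eq_zero h]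

theorem shiftCoeff_self (n : ℕ) (lam : YoungDiagram) :
    shiftCoeff n lam lam = (-1 : ℂ) ^ lam.card := by
  simp [shiftCoeff, numSYT_self, contentProd_self, skewCells]

/-- This is the recursion that `t`-differentiation imposes on the coefficients: contents multiply
along `nu ⊆ mu ⊆ lam`, and the tableau counts add up over `mu`. -/
theorem card_mul_shiftCoeff (n : ℕ) {lam nu : YoungDiagram} (h : nu ≤ lam) :
    ((skewCells lam nu).card : ℂ) * shiftCoeff n lam nu =
      ∑ mu ∈ lowerCovers lam, contentProd n lam mu * shiftCoeff n mu nu := by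
  have hc := card_skewCells_add h
  rcases Nat.eq_zero_or_pos (skewCells lam nu).card with h0 | hpos
  · rw [h0, Nat.cast_zero, zero_mul]
    symm
    refine sum_eq_zero fun mu hmu => ?_
    rw [mem_lowerCovers] at hmu
    rw [shiftCoeff_eq_zero, mul_zero]
    intro hle
    have := card_mono_diagram hle
    omega
  · obtain ⟨m, hm⟩ : ∃ m, (skewCells lam nu).card = m + 1 :=
      ⟨(skewCells lam nu).card - 1, by omega⟩
    have hterm : ∀ mu ∈ lowerCovers lam, contentProd n lam mu * shiftCoeff n mu nu =
        (-1 : ℂ) ^ nu.card * (contentProd n lam nu / (m.factorial : ℂ)) * numSYT mu nu := by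
      intro mu hmu
      rw [mem_lowerCovers] at hmu
      by_cases hle : nu ≤ mu
      · have h3 := card_skewCells_add hle
        rw [shiftCoeff, ← contentProd_mul n hle hmu.1, show (skewCells mu nu).card = m by omega]
        ring
      · rw [shiftCoeff_eq_zero n hle, numSYT_eq_zero hle]
        simp
    rw [sum_congr rfl hterm, ← mul_sum, shiftCoeff, numSYT_eq_sum (by omega : nu.card < lam.card),
      hm, Nat.factorial_succ]
    push_cast
    have h1 : (m.factorial : ℂ) ≠ 0 := Nat.cast_ne_zero.2 m.factorial_ne_zero
    have h2 : (m : ℂ) + 1 ≠ 0 := Nat.cast_add_one_ne_zero m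
    field_simp

/-- The substitution `x_i ↦ t - x_i`. -/
noncomputable def shiftHom (n : ℕ) :
    MvPolynomial (Fin n) ℂ →ₐ[ℂ] Polynomial (MvPolynomial (Fin n) ℂ) :=
  MvPolynomial.aeval (fun i => Polynomial.X - Polynomial.C (MvPolynomial.X i))

theorem shiftHom_X (n : ℕ) (i : Fin n) :
    shiftHom n (MvPolynomial.X i) = Polynomial.X - Polynomial.C (MvPolynomial.X i) :=
  MvPolynomial.aeval_X _ i

/-- Chain rule: `t - x_i` has `t`-derivative `1`, which is also `D x_i`. -/
theorem derivative_shiftHom (n : ℕ) (p : MvPolynomial (Fin n) ℂ) :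
    Polynomial.derivative (shiftHom n p) = shiftHom n (gradSum n p) := by
  induction p using MvPolynomial.induction_on with
  | C a =>
    rw [MvPolynomial.derivation_C, map_zero, ← MvPolynomial.algebraMap_eq, AlgHom.commutes,
      Polynomial.algebraMap_apply, Polynomial.derivative_C]
  | add p q hp hq => simp only [map_add, hp, hq]
  | mul_X p i hp =>
    rw [map_mul, Polynomial.derivative_mul, hp, shiftHom_X, (gradSum n).leibniz, gradSum_X, map_add]
    simp [shiftHom_X]
    ring

theorem eval_shiftHom {n : ℕ} (t : MvPolynomial (Fin n) ℂ) (p : MvPolynomial (Fin n) ℂ) :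
    (shiftHom n p).eval t = MvPolynomial.aeval (fun i => t - MvPolynomial.X i) p := by
  induction p using MvPolynomial.induction_on with
  | C a =>
    rw [← MvPolynomial.algebraMap_eq, AlgHom.commutes, AlgHom.commutes,
      Polynomial.algebraMap_apply, Polynomial.eval_C]
  | add p q hp hq => simp only [map_add, Polynomial.eval_add, hp, hq]
  | mul_X p i hp => simp [shiftHom_X, hp]

theorem Polynomial.eq_of_derivative_eq_of_eval_zero_eq {R : Type*} [CommRing R] [IsDomain R]
    [CharZero R] {p q : Polynomial R} (h : derivative p = derivative q)
    (h0 : p.eval 0 = q.eval 0) : p = q := by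
  ext k
  rcases k with _ | k
  · rwa [coeff_zero_eq_eval_zero, coeff_zero_eq_eval_zero]
  · have := congrArg (fun r => r.coeff k) h
    simp only [coeff_derivative] at this
    exact mul_right_cancel₀ (Nat.cast_add_one_ne_zero k) this

/-- Taylor expansion in `t`, by induction on the number of boxes: in characteristic zero the
derivative and the value at `0` determine a polynomial. -/
theorem shiftHom_schur {n : ℕ} {lam : YoungDiagram} (hlam : lam.colLen 0 ≤ n) :
    shiftHom n (schur n lam) = ∑ nu ∈ subdiagrams lam,
      Polynomial.C (shiftCoeff n lam nu • schur n nu) *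
        Polynomial.X ^ (skewCells lam nu).card := by
  classical
  induction hm : lam.card using Nat.strong_induction_on generalizing lam with
  | _ m ih =>
  refine Polynomial.eq_of_derivative_eq_of_eval_zero_eq ?_ ?_
  -- All expansions are written over the subdiagrams of `lam`. Extra terms have zero coefficient,
  -- including `nu = lam`, where the exponent is truncated.
  · have hcov : ∀ mu ∈ lowerCovers lam, shiftHom n (schur n mu) = ∑ nu ∈ subdiagrams lam,
        Polynomial.C (shiftCoeff n mu nu • schur n nu) *
          Polynomial.X ^ ((skewCells lam nu).card - 1) := by
      intro mu hmu
      rw [mem_lowerCovers] at hmu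
      rw [ih mu.card (by omega) ((colLen_le_of_le hmu.1 0).trans hlam) rfl]
      have hsub : subdiagrams mu ⊆ subdiagrams lam := fun nu h =>
        mem_subdiagrams.2 ((mem_subdiagrams.1 h).trans hmu.1)
      rw [← sum_subset hsub]
      · refine sum_congr rfl fun nu hnu => ?_
        rw [mem_subdiagrams] at hnu
        have h1 := card_skewCells_add hnu
        have h2 := card_skewCells_add (hnu.trans hmu.1)
        rw [show (skewCells mu nu).card = (skewCells lam nu).card - 1 by omega]
      · intro nu _ hnu
        rw [mem_subdiagrams] at hnu
        rw [shiftCoeff_eq_zero n hnu, zero_smul, map_zero, zero_mul]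
    rw [derivative_shiftHom, gradSum_schur hlam, map_sum, map_sum]
    simp only [map_smul]
    rw [sum_congr rfl fun mu hmu => by rw [hcov mu hmu, smul_sum], sum_comm]
    refine sum_congr rfl fun nu hnu => ?_
    rw [Polynomial.derivative_C_mul, Polynomial.derivative_X_pow, ← mul_assoc]
    have h1 : Polynomial.C (shiftCoeff n lam nu • schur n nu) *
        Polynomial.C ((skewCells lam nu).card : MvPolynomial (Fin n) ℂ) =
        Polynomial.C ((((skewCells lam nu).card : ℂ) * shiftCoeff n lam nu) • schur n nu) := by
      rw [← Polynomial.C_mul, mul_smul]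
      congr 1
      rw [mul_comm, ← map_natCast MvPolynomial.C, ← MvPolynomial.smul_eq_C_mul, smul_comm]
    rw [h1, card_mul_shiftCoeff n (mem_subdiagrams.1 hnu), sum_smul, map_sum, sum_mul]
    refine sum_congr rfl fun mu _ => ?_
    rw [← smul_mul_assoc, mul_smul, Polynomial.smul_C]
  -- At `t = 0` only `nu = lam` remains; its sign is the one from homogeneity of `s_lam`.
  · rw [eval_shiftHom]
    simp only [zero_sub]
    rw [aeval_neg_schur, Polynomial.eval_finsetSum, sum_eq_single lam]
    · simp [skewCells, shiftCoeff_self]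
    · intro nu hnu hne
      rw [mem_subdiagrams] at hnu
      have h1 := card_skewCells_add hnu
      have h2 : (skewCells lam nu).card ≠ 0 := fun h0 =>
        hne (eq_of_le_of_card_le hnu (by omega))
      simp [h2]
    · intro h
      exact absurd (mem_subdiagrams.2 le_rfl) h

theorem schurBar_eq_sum {n : ℕ} {lam : YoungDiagram} (hlam : lam.colLen 0 ≤ n) :
    schurBar n lam = ∑ nu ∈ subdiagrams lam,
      shiftCoeff n lam nu • (schur n nu * schur n oneBox ^ (skewCells lam nu).card) := by
  rw [schurBar, ← eval_shiftHom, shiftHom_schur hlam, Polynomial.eval_finsetSum, schur_oneBox]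
  refine sum_congr rfl fun nu _ => ?_
  simp

/-! ### The number of semistandard tableaux -/

/-- Evaluate the Taylor expansion at `t = 1` and all variables `0`: the left side counts tableaux,
and every nonempty `nu` contributes zero. -/
theorem card_SSYT_eq {n : ℕ} {lam : YoungDiagram} (hlam : lam.colLen 0 ≤ n) :
    ((SSYT lam.cells n).card : ℂ) =
      numSYT lam ⊥ * contentProd n lam ⊥ / (lam.card.factorial : ℂ) := by
  have h := congrArg (fun p => MvPolynomial.aeval (fun _ : Fin n => (0 : ℂ)) (p.eval 1))
    (shiftHom_schur hlam)
  simp only [eval_shiftHom, Polynomial.eval_finsetSum, map_sum] at h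
  rw [aeval_schur, tableauSum, map_sum, sum_eq_single (⊥ : YoungDiagram)] at h
  · have hb : (skewCells lam ⊥).card = lam.card := by
      simp [skewCells, YoungDiagram.card]
    simp [schur_bot, shiftCoeff, hb, card_bot_diagram] at h
    rw [h]
    ring
  · intro nu _ hne
    have hne' : Nonempty nu.cells := by
      by_contra hemp
      rw [nonempty_coe_sort, not_nonempty_iff_eq_empty] at hemp
      exact hne (eq_bot_of_cells_eq_empty hemp)
    have h0 : tableauSum nu.cells (fun _ : Fin n => (0 : ℂ)) = 0 :=
      sum_eq_zero fun T _ => prod_eq_zero (mem_univ hne'.some) rfl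
    rw [← aeval_schur] at h0
    rw [Polynomial.eval_mul, Polynomial.eval_C, Polynomial.eval_pow, Polynomial.eval_X, one_pow,
      mul_one, map_smul, h0, smul_zero]
  · intro hb
    exact absurd (mem_subdiagrams.2 bot_le) hb

theorem lowerCovers_nonempty {lam : YoungDiagram} (h : 0 < lam.card) :
    (lowerCovers lam).Nonempty := by
  obtain ⟨b, hb⟩ := lam.cells.exists_maximal (card_pos.1 h)
  have hlow : IsLowerSet (lam.cells.erase b : Set (ℕ × ℕ)) := by
    intro a a' hle ha
    rw [mem_coe, mem_erase] at ha ⊢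
    refine ⟨?_, lam.isLowerSet hle ha.2⟩
    rintro rfl
    exact ha.1 (le_antisymm (hb.2 ha.2 hle) hle)
  refine ⟨⟨lam.cells.erase b, hlow⟩, mem_lowerCovers.2 ⟨?_, ?_⟩⟩
  · exact erase_subset _ _
  · exact card_erase_add_one hb.1

theorem numSYT_bot_pos (lam : YoungDiagram) : 0 < numSYT lam ⊥ := by
  induction hm : lam.card using Nat.strong_induction_on generalizing lam with
  | _ m ih =>
  rcases Nat.eq_zero_or_pos lam.card with h0 | hpos
  · rw [eq_bot_of_cells_eq_empty (card_eq_zero.1 h0), numSYT_self]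
    exact one_pos
  · rw [numSYT_eq_sum (by rwa [card_bot_diagram])]
    refine sum_pos (fun mu hmu => ih mu.card ?_ mu rfl) (lowerCovers_nonempty hpos)
    have := (mem_lowerCovers.1 hmu).2
    omega

/-- Rows of `lam` are numbered at most `n`, so each factor is a positive integer. -/
theorem contentProd_ne_zero {n : ℕ} {lam : YoungDiagram} (hlam : lam.colLen 0 ≤ n)
    (nu : YoungDiagram) : contentProd n lam nu ≠ 0 := by
  rw [contentProd, prod_ne_zero_iff]
  rintro ⟨i, j⟩ hb
  have h1 : (i, j) ∈ lam := (mem_sdiff.1 hb).1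
  have h0 : (i, 0) ∈ lam := lam.up_left_mem le_rfl (Nat.zero_le j) h1
  have hi : i < n := (YoungDiagram.mem_iff_lt_colLen.1 h0).trans_le hlam
  have h2 : (n : ℂ) = ((n - (i + 1) : ℕ) : ℂ) + ((i : ℂ) + 1) := by
    exact_mod_cast (by omega : n = n - (i + 1) + (i + 1))
  have h3 : (n : ℂ) - ((i : ℂ) + 1) + ((j : ℂ) + 1) = ((n - (i + 1) + j : ℕ) : ℂ) + 1 := by
    rw [h2]
    push_cast
    ring
  simp only
  rw [h3]
  exact Nat.cast_add_one_ne_zero _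

/-! ### Expansion in Schur polynomials -/

/-- Iterated Pieri: chains of added boxes from `nu` to `mu` are counted by the same recursion as
standard tableaux. -/
theorem schur_mul_pow (n : ℕ) (nu : YoungDiagram) (k : ℕ) :
    schur n nu * schur n oneBox ^ k =
      ∑ mu ∈ diagramsOfCard (nu.card + k), (numSYT mu nu : ℂ) • schur n mu := by
  classical
  induction k with
  | zero =>
    rw [pow_zero, mul_one, add_zero, sum_eq_single nu]
    · rw [numSYT_self, Nat.cast_one, one_smul]
    · intro mu hmu hne
      rw [mem_diagramsOfCard] at hmu
      rw [numSYT_eq_zero, Nat.cast_zero, zero_smul]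
      exact fun hle => hne (eq_of_le_of_card_le hle hmu.le).symm
    · intro h
      exact absurd (mem_diagramsOfCard.2 rfl) h
  | succ k ih =>
    rw [pow_succ, ← mul_assoc, ih, schur_oneBox, sum_mul]
    have hstep : ∀ mu ∈ diagramsOfCard (nu.card + k),
        (numSYT mu nu : ℂ) • schur n mu * ∑ i : Fin n, MvPolynomial.X i =
          ∑ mu' ∈ diagramsOfCard (nu.card + (k + 1)),
            (if mu ≤ mu' then (numSYT mu nu : ℂ) else 0) • schur n mu' := by
      intro mu hmu
      rw [mem_diagramsOfCard] at hmu
      rw [smul_mul_assoc, mul_comm, sum_X_mul_schur, smul_sum, hmu, add_assoc]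
      refine sum_congr rfl fun mu' _ => ?_
      split_ifs <;> simp
    rw [sum_congr rfl hstep, sum_comm]
    refine sum_congr rfl fun mu' hmu' => ?_
    rw [mem_diagramsOfCard] at hmu'
    rw [← sum_smul, ← sum_filter, numSYT_eq_sum (by omega : nu.card < mu'.card), Nat.cast_sum]
    congr 1
    refine sum_congr ?_ fun _ _ => rfl
    ext mu
    rw [mem_filter, mem_diagramsOfCard, mem_lowerCovers, and_comm]
    refine and_congr_right fun _ => ?_
    omega

theorem sum_subdiagrams_inf (n : ℕ) (lam mu : YoungDiagram) :
    ∑ nu ∈ subdiagrams lam, shiftCoeff n lam nu * (numSYT mu nu : ℂ) =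
      ∑ nu ∈ subdiagrams (lam ⊓ mu), (-1 : ℂ) ^ nu.card *
        ((numSYT lam nu : ℂ) * (numSYT mu nu : ℂ) * contentProd n lam nu /
          ((skewCells lam nu).card.factorial : ℂ)) := by
  have hsub : subdiagrams (lam ⊓ mu) ⊆ subdiagrams lam := fun nu h =>
    mem_subdiagrams.2 ((mem_subdiagrams.1 h).trans inf_le_left)
  rw [← sum_subset hsub]
  · refine sum_congr rfl fun nu _ => ?_
    rw [shiftCoeff]
    ring
  · intro nu h1 h2
    rw [mem_subdiagrams] at h1 h2
    rw [numSYT_eq_zero (lam := mu), Nat.cast_zero, mul_zero]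
    exact fun h3 => h2 (le_inf h1 h3)

theorem schurBar_eq_sum_schur {n : ℕ} {lam : YoungDiagram} (hlam : lam.colLen 0 ≤ n) :
    schurBar n lam = ∑ mu ∈ diagramsOfCard lam.card,
      (∑ nu ∈ subdiagrams lam, shiftCoeff n lam nu * (numSYT mu nu : ℂ)) • schur n mu := by
  simp only [sum_smul]
  rw [schurBar_eq_sum hlam, sum_comm]
  refine sum_congr rfl fun nu hnu => ?_
  have h1 := card_skewCells_add (mem_subdiagrams.1 hnu)
  rw [schur_mul_pow, smul_sum, show nu.card + (skewCells lam nu).card = lam.card by omega]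
  refine sum_congr rfl fun mu _ => ?_
  rw [smul_smul]

/-- Apply `card_SSYT_eq` to `lam` and to `nu`. In the quotient the contents of `nu` cancel, and the
factorials combine with the binomial coefficient. -/
theorem numSYT_mul_contentProd_div {n : ℕ} {lam nu : YoungDiagram} (hlam : lam.colLen 0 ≤ n)
    (h : nu ≤ lam) :
    (numSYT lam nu : ℂ) * contentProd n lam nu / ((skewCells lam nu).card.factorial : ℂ) =
      (lam.card.choose nu.card : ℂ) *
        ((numSYT nu ⊥ : ℂ) * (numSYT lam nu : ℂ) / (numSYT lam ⊥ : ℂ)) *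
        (((SSYT lam.cells n).card : ℂ) / ((SSYT nu.cells n).card : ℂ)) := by
  have hnu := (colLen_le_of_le h 0).trans hlam
  have h1 : (numSYT nu ⊥ : ℂ) ≠ 0 := Nat.cast_ne_zero.2 (numSYT_bot_pos nu).ne'
  have h2 : (numSYT lam ⊥ : ℂ) ≠ 0 := Nat.cast_ne_zero.2 (numSYT_bot_pos lam).ne'
  have h3 := contentProd_ne_zero hnu ⊥
  have hf : ∀ m : ℕ, (m.factorial : ℂ) ≠ 0 := fun m => Nat.cast_ne_zero.2 m.factorial_ne_zero
  have hcard := card_skewCells_add h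
  have h4 : (lam.card.choose nu.card : ℂ) * nu.card.factorial *
      (skewCells lam nu).card.factorial = lam.card.factorial := by
    have := Nat.choose_mul_factorial_mul_factorial (card_mono_diagram h)
    rw [show lam.card - nu.card = (skewCells lam nu).card by omega] at this
    exact_mod_cast this
  have h5 : (lam.card.choose nu.card : ℂ) = lam.card.factorial /
      (nu.card.factorial * (skewCells lam nu).card.factorial) := by
    rw [eq_div_iff (mul_ne_zero (hf _) (hf _)), ← h4]
    ring
  rw [card_SSYT_eq hlam, card_SSYT_eq hnu, h5, ← contentProd_mul n bot_le h]
  have h6 := hf lam.card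
  have h7 := hf nu.card
  have h8 := hf (skewCells lam nu).card
  field_simp

theorem lemma3p1 (n : ℕ) (lam : Par n) :
    (schurBar n lam.1 =
      ∑ nu ∈ subdiagrams lam.1,
        ((-1 : ℂ) ^ nu.card * (numSYT lam.1 nu : ℂ) *
            (contentProd n lam.1 nu / ((skewCells lam.1 nu).card.factorial : ℂ))) •
          (schur n nu * schur n oneBox ^ (skewCells lam.1 nu).card)) ∧
    ∃ c : Par n →₀ ℂ,
      IsSchurExpansion (schurBar n lam.1) c ∧
      (∀ c' : Par n →₀ ℂ, IsSchurExpansion (schurBar n lam.1) c' → c' = c) ∧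
      ∀ mu : Par n,
        (mu.1.card ≠ lam.1.card → c mu = 0) ∧
        (mu.1.card = lam.1.card →
          c mu = ∑ nu ∈ subdiagrams (lam.1 ⊓ mu.1),
            (-1 : ℂ) ^ nu.card *
              ((numSYT lam.1 nu : ℂ) * (numSYT mu.1 nu : ℂ) * contentProd n lam.1 nu /
                ((skewCells lam.1 nu).card.factorial : ℂ))) ∧
        (∑ nu ∈ subdiagrams (lam.1 ⊓ mu.1),
            (-1 : ℂ) ^ nu.card *
              ((numSYT lam.1 nu : ℂ) * (numSYT mu.1 nu : ℂ) * contentProd n lam.1 nu /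
                ((skewCells lam.1 nu).card.factorial : ℂ)) =
          ∑ nu ∈ subdiagrams (lam.1 ⊓ mu.1),
            (-1 : ℂ) ^ nu.card * (lam.1.card.choose nu.card : ℂ) * (numSYT mu.1 nu : ℂ) *
              ((numSYT nu ⊥ : ℂ) * (numSYT lam.1 nu : ℂ) / (numSYT lam.1 ⊥ : ℂ)) *
              (((SSYT lam.1.cells n).card : ℂ) / ((SSYT nu.cells n).card : ℂ))) := by
  classical
  refine ⟨schurBar_eq_sum lam.2, ?_⟩
  let K : Par n → ℂ := fun mu => if mu.1.card = lam.1.card then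
    ∑ nu ∈ subdiagrams lam.1, shiftCoeff n lam.1 nu * (numSYT mu.1 nu : ℂ) else 0
  -- Diagrams with more than `n` rows may be discarded from the expansion, since their Schur
  -- polynomials vanish.
  let S : Finset (Par n) := (diagramsOfCard lam.1.card).subtype (fun mu => mu.colLen 0 ≤ n)
  have hS : ∀ mu : Par n, K mu ≠ 0 → mu ∈ S := by
    intro mu hmu
    rw [mem_subtype, mem_diagramsOfCard]
    by_contra hne
    exact hmu (if_neg hne)
  have hexp : IsSchurExpansion (schurBar n lam.1) (Finsupp.onFinset S K hS) := by
    rw [IsSchurExpansion, Finsupp.onFinset_sum (g := fun (mu : Par n) (a : ℂ) => a • schur n mu.1) hS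
        (fun mu => zero_smul ℂ _),
      schurBar_eq_sum_schur lam.2, ← sum_filter_of_ne (p := fun mu => mu.colLen 0 ≤ n),
      ← sum_subtype_eq_sum_filter]
    · refine sum_congr rfl fun mu hmu => ?_
      rw [mem_subtype, mem_diagramsOfCard] at hmu
      simp only [K]
      rw [if_pos hmu]
    · intro mu _ hne
      by_contra hc
      rw [schur_eq_zero (not_le.1 hc), smul_zero] at hne
      exact hne rfl
  refine ⟨Finsupp.onFinset S K hS, hexp, fun c' hc' => ?_, fun mu => ⟨fun hne => ?_, fun heq => ?_,
    ?_⟩⟩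
  · refine linearIndependent_schur n ?_
    rw [Finsupp.linearCombination_apply, Finsupp.linearCombination_apply]
    exact hc'.symm.trans hexp
  · exact if_neg hne
  · rw [← sum_subdiagrams_inf]
    exact if_pos heq
  · refine sum_congr rfl fun nu hnu => ?_
    have h := numSYT_mul_contentProd_div lam.2 ((mem_subdiagrams.1 hnu).trans inf_le_left)
    calc _ = (-1 : ℂ) ^ nu.card * (numSYT mu.1 nu : ℂ) * ((numSYT lam.1 nu : ℂ) *
          contentProd n lam.1 nu / ((skewCells lam.1 nu).card.factorial : ℂ)) := by ring
      _ = _ := by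
        rw [h]
        ring
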